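/- Let $K$ be a field, $R=K[X_1,\dots,X_n]$ and $\mathfrak m=(X_1,\dots,X_n)$. For a weight $a=(a_1,\dots,a_n)$ of positive integers, the $a$-degree of $X^\alpha$ is $\sum_i \alpha_i a_i$; for $f\in R$ let $\mathrm{in}_a(f)$ be the sum of the terms of $f$ of largest $a$-degree, and for an ideal $I$ of $R$ let $\mathrm{in}_a(I)$ be the $K$-subspace (in fact, ideal) of $R$ generated by all $\mathrm{in}_a(f)$ with $f\in I$. For an ideal $J\subseteq R$ that is graded with respect to the weight $(1,\dots,1)$, the algebra $R/J$ is called Koszul if $\mathrm{Tor}_i^{R/J}(R/\mathfrak m,R/\mathfrak m)_j=0$ for all $i\neq j$, where $j$ refers to the grading induced by the standard grading of $R$ (by convention, the zero ring $R/R$ is Koszul). Let $I\subseteq R$ be an ideal that is graded with respect to the weight $(1,\dots,1)$. (a) If $R/\mathrm{in}_a(I)$ is Koszul for some positive integral weight $a$, then $R/I$ is Koszul. (b) In particular, if for some positive integral weight $a$ the ideal $\mathrm{in}_a(I)$ is generated by monomials of (standard) degree $2$, then $R/I$ is Koszul. -/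

import Mathlib

open scoped TensorProduct

noncomputable section

namespace KoszulTransfer

/-! ### Graded modules, graded free resolutions and graded Tor -/

section GradedTor

variable {K A : Type*} [CommRing K] [CommRing A] [Algebra K A]

/-- The grading induced by `𝒜` on the quotient of `A` by an ideal: the degree `j` component is the
image of `𝒜 j`. -/
def quotientGrading (𝒜 : ℕ → Submodule K A) (J : Ideal A) (j : ℕ) : Submodule K (A ⧸ J) :=
  (𝒜 j).map (Ideal.Quotient.mkₐ K J).toLinearMap

/-- The grading of the free `A`-module with basis `ι` in which the basis element `b` is homogeneous
of degree `d b`, that is, of the direct sum of the shifted modules `A(-d b)`.  An element is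
homogeneous of degree `j` if its coordinate at `b` is homogeneous of degree `j - d b`
(and zero if `j < d b`). -/
def freeGrading (𝒜 : ℕ → Submodule K A) {ι : Type*} (d : ι → ℕ) (j : ℕ) :
    Submodule K (ι →₀ A) where
  carrier := {f | ∀ b, (d b ≤ j → f b ∈ 𝒜 (j - d b)) ∧ (j < d b → f b = 0)}
  zero_mem' := fun b => ⟨fun _ => (𝒜 (j - d b)).zero_mem, fun _ => rfl⟩
  add_mem' := fun {f g} hf hg b =>
    ⟨fun h => (𝒜 (j - d b)).add_mem ((hf b).1 h) ((hg b).1 h),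
      fun h => by simp [(hf b).2 h, (hg b).2 h]⟩
  smul_mem' := fun c f hf b =>
    ⟨fun h => (𝒜 (j - d b)).smul_mem c ((hf b).1 h), fun h => by simp [(hf b).2 h]⟩

/-- The grading of a tensor product of graded modules: the degree `j` component is spanned by the
elements `x ⊗ y` with `x`, `y` homogeneous of degrees `p`, `q` such that `p + q = j`. -/
def tensorGrading {M N : Type*} [AddCommMonoid M] [AddCommMonoid N] [Module A M] [Module A N]
    [Module K M] [Module K N] [IsScalarTower K A M] [IsScalarTower K A N]
    (ℳ : ℕ → Submodule K M) (𝒩 : ℕ → Submodule K N) (j : ℕ) : Submodule K (M ⊗[A] N) :=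
  Submodule.span K {z | ∃ p q x y, p + q = j ∧ x ∈ ℳ p ∧ y ∈ 𝒩 q ∧ z = x ⊗ₜ[A] y}

/-- A graded free resolution
`⋯ → F₂ → F₁ → F₀ → A ⧸ J → 0`
of the graded `A`-module `A ⧸ J`: each `Fᵢ` is free on homogeneous basis elements, and all maps
are `A`-linear and preserve degrees. -/
structure GradedFreeResolution (𝒜 : ℕ → Submodule K A) (J : Ideal A) where
  /-- the index set of the basis of `Fᵢ` -/
  basis : ℕ → Type
  /-- the degrees of the basis elements of `Fᵢ` -/
  deg : ∀ i, basis i → ℕ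
  /-- the differential `Fᵢ₊₁ → Fᵢ` -/
  diff : ∀ i, (basis (i + 1) →₀ A) →ₗ[A] (basis i →₀ A)
  /-- the augmentation `F₀ → A ⧸ J` -/
  aug : (basis 0 →₀ A) →ₗ[A] (A ⧸ J)
  diff_mem : ∀ i j, ∀ f ∈ freeGrading 𝒜 (deg (i + 1)) j, diff i f ∈ freeGrading 𝒜 (deg i) j
  aug_mem : ∀ j, ∀ f ∈ freeGrading 𝒜 (deg 0) j, aug f ∈ quotientGrading 𝒜 J j
  exact_diff : ∀ i, Function.Exact (diff (i + 1)) (diff i)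
  exact_aug : Function.Exact (diff 0) aug
  aug_surjective : Function.Surjective aug

namespace GradedFreeResolution

variable {𝒜 : ℕ → Submodule K A} {J : Ideal A} (F : GradedFreeResolution 𝒜 J) (L : Ideal A)

/-- The module of `i`-chains `(A ⧸ L) ⊗ Fᵢ` of the complex `(A ⧸ L) ⊗ F`. -/
abbrev Chain (i : ℕ) : Type _ := (A ⧸ L) ⊗[A] (F.basis i →₀ A)

/-- The differential `(A ⧸ L) ⊗ Fᵢ₊₁ → (A ⧸ L) ⊗ Fᵢ`. -/
def chainDiff (i : ℕ) : F.Chain L (i + 1) →ₗ[A] F.Chain L i :=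
  (F.diff i).lTensor (A ⧸ L)

/-- The `i`-cycles of the complex `⋯ → (A ⧸ L) ⊗ F₁ → (A ⧸ L) ⊗ F₀ → 0`. -/
def cycles : ∀ i, Submodule A (F.Chain L i)
  | 0 => ⊤
  | i + 1 => LinearMap.ker (F.chainDiff L i)

/-- The `i`-boundaries of the complex `⋯ → (A ⧸ L) ⊗ F₁ → (A ⧸ L) ⊗ F₀ → 0`. -/
def boundaries (i : ℕ) : Submodule A (F.Chain L i) :=
  LinearMap.range (F.chainDiff L i)

/-- The `i`-cycles that are homogeneous of degree `j`. -/
def homogeneousCycles (i j : ℕ) : Submodule K (F.Chain L i) :=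
  (F.cycles L i).restrictScalars K ⊓
    tensorGrading (quotientGrading 𝒜 L) (freeGrading 𝒜 (F.deg i)) j

/-- The graded component `Tor_i^A(A ⧸ L, A ⧸ J)_j`, computed from the graded free resolution `F` of
`A ⧸ J`: the classes of the homogeneous `i`-cycles of degree `j` of `(A ⧸ L) ⊗ F` modulo
boundaries, as a `K`-subspace of the `i`-chains modulo the `i`-boundaries. -/
def tor (i j : ℕ) : Submodule K (F.Chain L i ⧸ F.boundaries L i) :=
  (F.homogeneousCycles L i j).map ((F.boundaries L i).mkQ.restrictScalars K)

end GradedFreeResolution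

end GradedTor

/-! ### Koszul algebras and initial ideals -/

section Polynomial

open MvPolynomial

variable {K : Type*} [Field K] {n : ℕ}

/-- The standard grading (all variables of degree one) of the residue class ring `R/I`. -/
def standardGrading (I : Ideal (MvPolynomial (Fin n) K)) :
    ℕ → Submodule K (MvPolynomial (Fin n) K ⧸ I) :=
  quotientGrading (homogeneousSubmodule (Fin n) K) I

/-- The ideal of `R/I` generated by the residue classes of the variables. -/
def maximalIdeal (I : Ideal (MvPolynomial (Fin n) K)) : Ideal (MvPolynomial (Fin n) K ⧸ I) :=
  (Ideal.span (Set.range (X : Fin n → MvPolynomial (Fin n) K))).map (Ideal.Quotient.mk I)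

/-- `R/I` is Koszul (for `I` graded with respect to the weight `(1,…,1)`):
`Tor_i^{R/I}(R/𝔪, R/𝔪)_j = 0` for all `i ≠ j`, where the graded Tor is computed from a graded free
resolution of `R/𝔪` over `R/I`.  (Up to isomorphism it does not depend on the resolution.) -/
def IsKoszul (I : Ideal (MvPolynomial (Fin n) K)) : Prop :=
  ∃ F : GradedFreeResolution (standardGrading I) (maximalIdeal I),
    ∀ i j : ℕ, i ≠ j → F.tor (maximalIdeal I) i j = ⊥

/-- The initial form `in_a(f)`: the sum of the terms of `f` of largest `a`-degree. -/
def initialForm (a : Fin n → ℕ) (f : MvPolynomial (Fin n) K) : MvPolynomial (Fin n) K :=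
  weightedHomogeneousComponent a (weightedTotalDegree a f) f

lemma monomial_mul_initialForm (a : Fin n → ℕ) (m : Fin n →₀ ℕ) {c : K} (hc : c ≠ 0)
    (f : MvPolynomial (Fin n) K) :
    monomial m c * initialForm a f = initialForm a (monomial m c * f) := by
  classical
  rcases eq_or_ne f 0 with rfl | hf
  · simp [initialForm]
  have hsup : (monomial m c * f).support = f.support.map (addLeftEmbedding m) := by
    ext d
    simp only [mem_support_iff, coeff_monomial_mul', Finset.mem_map, addLeftEmbedding_apply]
    constructor
    · intro h
      split_ifs at h with hmd
      · exact ⟨d - m, right_ne_zero_of_mul h, add_tsub_cancel_of_le hmd⟩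
      · exact absurd rfl h
    · rintro ⟨e, he, rfl⟩
      simp [hc, he]
  have hdeg : weightedTotalDegree a (monomial m c * f)
      = Finsupp.weight a m + weightedTotalDegree a f := by
    have hne : f.support.Nonempty := by simpa [Finset.nonempty_iff_ne_empty] using hf
    unfold weightedTotalDegree
    rw [hsup, Finset.sup_map]
    rw [← Finset.sup'_eq_sup hne, ← Finset.sup'_eq_sup hne]
    refine Eq.trans ?_ (Finset.add_sup'' hne _ _).symm
    simp
  ext d
  simp only [initialForm, hdeg, coeff_monomial_mul', coeff_weightedHomogeneousComponent]
  by_cases hmd : m ≤ d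
  · obtain ⟨e, rfl⟩ := exists_add_of_le hmd
    simp
  · simp [hmd]

/-- The initial ideal `in_a(I)`: the `K`-subspace of `R` generated by the `in_a(f)` with `f ∈ I`,
which is an ideal of `R`. -/
def initialIdeal (a : Fin n → ℕ) (I : Ideal (MvPolynomial (Fin n) K)) :
    Ideal (MvPolynomial (Fin n) K) where
  carrier := Submodule.span K (initialForm a '' (I : Set (MvPolynomial (Fin n) K)))
  zero_mem' := Submodule.zero_mem _
  add_mem' := fun hf hg => Submodule.add_mem _ hf hg
  smul_mem' := by
    intro r f hf
    change r * f ∈ Submodule.span K (initialForm a '' (I : Set (MvPolynomial (Fin n) K)))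
    change f ∈ Submodule.span K (initialForm a '' (I : Set (MvPolynomial (Fin n) K))) at hf
    induction r using MvPolynomial.induction_on' with
    | monomial m c =>
      rcases eq_or_ne c 0 with rfl | hc
      · simp
      induction hf using Submodule.span_induction with
      | mem x hx =>
        obtain ⟨g, hg, rfl⟩ := hx
        exact Submodule.subset_span
          ⟨monomial m c * g, I.mul_mem_left _ hg, (monomial_mul_initialForm a m hc g).symm⟩
      | zero => simp
      | add x y _ _ hx hy => rw [mul_add]; exact Submodule.add_mem _ hx hy
      | smul k x _ hx => rw [mul_smul_comm]; exact Submodule.smul_mem _ _ hx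
    | add p q hp hq => rw [add_mul]; exact Submodule.add_mem _ hp hq

end Polynomial

end KoszulTransfer

end

/-! A linear free resolution of the residue field forces Tor onto the diagonal, because tensoring
A(-i)^r with A/𝔪 leaves only degree i (`isKoszulAlgebra_of_linear`). Both halves of the theorem
therefore come down to constructing linear resolutions.

For (a), B = R/in_a(I) is the associated graded ring of A = R/I for the filtration by a-weight. A
linear resolution over B is built together with a lift to A, so that at every step the syzygy module
over B consists of the symbols of the syzygy module over A. The given resolution over B need not be
minimal; that the syzygies over B are generated in a single degree is obtained by comparing them, up
to stable equivalence, with the syzygies of that resolution (`stablyEquivalent_ker`, `le_span`).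
Weight-homogeneous linear generators are then lifted to A. Since weights are natural numbers, a
filtered map with surjective symbol is surjective with control of weights
(`exists_freeRel_preimage`); hence exactness lifts, and the new kernels are again related by symbols
(`Degeneration.Stage.exists_next`).

For (b), modulo a quadratic monomial ideal the colon of an ideal of variables by a further variable
is generated by variables (`isKoszulFamily_var`). Linear quotients of this kind pass to first
syzygies (`LinearQuotients.exists_next`), so the residue field has a linear resolution over
R/in_a(I), and (a) applies. -/

noncomputable section

namespace KoszulTransfer

/-! ### Projections onto homogeneous components -/

section Projections

variable {K : Type*} [CommRing K]

/-- Projections of a module onto the components of a grading. -/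
structure HomogProj {M : Type*} [AddCommGroup M] [Module K M] (ℳ : ℕ → Submodule K M) where
  /-- the projection onto the component of degree `j` -/
  proj : ℕ → M →ₗ[K] M
  proj_same : ∀ {j x}, x ∈ ℳ j → proj j x = x
  proj_ne : ∀ {j k x}, x ∈ ℳ k → k ≠ j → proj j x = 0
  mem_iSup : ∀ x, x ∈ ⨆ j, ℳ j

namespace HomogProj

variable {M N : Type*} [AddCommGroup M] [Module K M] [AddCommGroup N] [Module K N]
  {ℳ : ℕ → Submodule K M} {𝒩 : ℕ → Submodule K N}

lemma induction (P : HomogProj ℳ) {p : M → Prop} (h0 : p 0) (hadd : ∀ x y, p x → p y → p (x + y))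
    (hmem : ∀ j, ∀ x ∈ ℳ j, p x) (x : M) : p x :=
  Submodule.iSup_induction ℳ (motive := p) (P.mem_iSup x) hmem h0 hadd

lemma proj_mem (P : HomogProj ℳ) (j : ℕ) (x : M) : P.proj j x ∈ ℳ j := by
  induction x using P.induction with
  | h0 => simp
  | hadd x y hx hy => rw [map_add]; exact add_mem hx hy
  | hmem k x hx =>
    by_cases h : k = j
    · subst h; rwa [P.proj_same hx]
    · simp [P.proj_ne hx h]

lemma exists_sum_range (P : HomogProj ℳ) (x : M) : ∃ N, ∀ N', N ≤ N' → ∑ j ∈ Finset.range N', P.proj j x = x := by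
  induction x using P.induction with
  | h0 => exact ⟨0, by simp⟩
  | hadd x y hx hy =>
    obtain ⟨a, ha⟩ := hx
    obtain ⟨b, hb⟩ := hy
    refine ⟨max a b, fun c hc => ?_⟩
    simp only [map_add, Finset.sum_add_distrib]
    rw [ha c (le_trans (le_max_left _ _) hc), hb c (le_trans (le_max_right _ _) hc)]
  | hmem k x hx =>
    refine ⟨k + 1, fun c hc => ?_⟩
    rw [Finset.sum_eq_single k, P.proj_same hx]
    · exact fun b _ hb => P.proj_ne hx (Ne.symm hb)
    · intro h; exact absurd (Finset.mem_range.2 (by omega)) h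

lemma mem_of_proj_mem (P : HomogProj ℳ) {S : Type*} [SetLike S M] [AddSubmonoidClass S M] (L : S) {x : M}
    (h : ∀ j, P.proj j x ∈ L) : x ∈ L := by
  obtain ⟨c, hc⟩ := P.exists_sum_range x
  rw [← hc c le_rfl]
  exact sum_mem fun j _ => h j

/-- Additivity of the map suffices, so `A`-linear differentials are covered although the projections
are only `K`-linear. -/
lemma map_proj (P : HomogProj ℳ) (Q : HomogProj 𝒩) {F : Type*} [FunLike F M N] [AddMonoidHomClass F M N] (φ : F)
    (h : ∀ j, ∀ x ∈ ℳ j, φ x ∈ 𝒩 j) (j : ℕ) (x : M) : φ (P.proj j x) = Q.proj j (φ x) := by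
  induction x using P.induction with
  | h0 => simp
  | hadd x y hx hy => simp [hx, hy]
  | hmem k x hx =>
    by_cases hk : k = j
    · subst hk; rw [P.proj_same hx, Q.proj_same (h _ _ hx)]
    · rw [P.proj_ne hx hk, Q.proj_ne (h _ _ hx) hk, map_zero]

/-- A map that raises degrees by `d` intertwines the projections. -/
lemma map_proj_add (P : HomogProj ℳ) (Q : HomogProj 𝒩) {F : Type*} [FunLike F M N] [AddMonoidHomClass F M N] (φ : F) {d : ℕ}
    (h : ∀ j, ∀ x ∈ ℳ j, φ x ∈ 𝒩 (d + j)) (j : ℕ) (x : M) :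
    Q.proj (d + j) (φ x) = φ (P.proj j x) := by
  induction x using P.induction with
  | h0 => simp
  | hadd x y hx hy => simp [hx, hy]
  | hmem k x hx =>
    by_cases hk : k = j
    · subst hk; rw [P.proj_same hx, Q.proj_same (h _ _ hx)]
    · rw [P.proj_ne hx hk, Q.proj_ne (h _ _ hx) (by omega), map_zero]

lemma proj_eq_zero_of_lt (P : HomogProj ℳ) (Q : HomogProj 𝒩) {F : Type*} [FunLike F M N] [AddMonoidHomClass F M N] (φ : F) {d : ℕ}
    (h : ∀ j, ∀ x ∈ ℳ j, φ x ∈ 𝒩 (d + j)) {i : ℕ} (hi : i < d) (x : M) :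
    Q.proj i (φ x) = 0 := by
  induction x using P.induction with
  | h0 => simp
  | hadd x y hx hy => simp [hx, hy]
  | hmem k x hx => exact Q.proj_ne (h _ _ hx) (by omega)

end HomogProj

variable {A : Type*} [CommRing A] [Algebra K A] {𝒜 : ℕ → Submodule K A}

lemma mk_mem_quotientGrading {J : Ideal A} {j : ℕ} {x : A} (hx : x ∈ 𝒜 j) :
    Ideal.Quotient.mk J x ∈ quotientGrading 𝒜 J j :=
  ⟨x, hx, rfl⟩

/-- The projections of a quotient by a homogeneous ideal. -/
def HomogProj.quotient (P : HomogProj 𝒜) (J : Ideal A) (hJ : ∀ x ∈ J, ∀ j, P.proj j x ∈ J) :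
    HomogProj (quotientGrading 𝒜 J) where
  proj j := Submodule.mapQ (J.restrictScalars K) (J.restrictScalars K) (P.proj j)
    fun x hx => hJ x hx j
  proj_same := by
    rintro j _ ⟨x, hx, rfl⟩
    exact congrArg (Ideal.Quotient.mk J) (P.proj_same hx)
  proj_ne := by
    rintro j k _ ⟨x, hx, rfl⟩ h
    exact (congrArg (Ideal.Quotient.mk J) (P.proj_ne hx h)).trans (map_zero _)
  mem_iSup x := by
    obtain ⟨x, rfl⟩ := Ideal.Quotient.mk_surjective x
    simp only [quotientGrading, ← Submodule.map_iSup]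
    exact ⟨x, P.mem_iSup x, rfl⟩

@[simp] lemma HomogProj.quotient_proj_mk (P : HomogProj 𝒜) (J : Ideal A)
    (hJ : ∀ x ∈ J, ∀ j, P.proj j x ∈ J) (j : ℕ) (x : A) :
    (P.quotient J hJ).proj j (Ideal.Quotient.mk J x) = Ideal.Quotient.mk J (P.proj j x) := rfl

variable {ι κ : Type*}

lemma single_mem_freeGrading {d : ι → ℕ} {b : ι} {j : ℕ} {x : A} (hx : x ∈ 𝒜 j) :
    Finsupp.single b x ∈ freeGrading 𝒜 d (d b + j) := by
  intro c
  by_cases h : b = c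
  · subst h; simpa using hx
  · simp [Finsupp.single_eq_of_ne' h]

/-- The projections of a graded free module. -/
def HomogProj.free (P : HomogProj 𝒜) (d : ι → ℕ) : HomogProj (freeGrading 𝒜 d) where
  proj j :=
    { toFun := fun f => Finsupp.onFinset f.support
        (fun b => if d b ≤ j then P.proj (j - d b) (f b) else 0) (by
          intro b hb; rw [Finsupp.mem_support_iff]; rintro h; simp [h] at hb)
      map_add' := fun f g => by
        ext b; by_cases h : d b ≤ j <;> simp [h]
      map_smul' := fun c f => by
        ext b; by_cases h : d b ≤ j <;> simp [h] }
  proj_same := by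
    intro j f hf
    ext b
    by_cases h : d b ≤ j
    · simpa [h] using P.proj_same ((hf b).1 h)
    · simpa [h] using ((hf b).2 (by omega)).symm
  proj_ne := by
    intro j k f hf hk
    ext b
    by_cases h : d b ≤ j
    · by_cases h' : d b ≤ k
      · simpa [h] using P.proj_ne ((hf b).1 h') (by omega)
      · simp [(hf b).2 (by omega)]
    · simp [h]
  mem_iSup f := by
    induction f using Finsupp.induction_linear with
    | zero => exact zero_mem _
    | add f g hf hg => exact add_mem hf hg
    | single b x =>
      induction x using P.induction with
      | h0 => simp
      | hadd x y hx hy => rw [Finsupp.single_add]; exact add_mem hx hy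
      | hmem j x hx => exact Submodule.mem_iSup_of_mem _ (single_mem_freeGrading hx)

lemma HomogProj.free_proj_apply (P : HomogProj 𝒜) (d : ι → ℕ) (j : ℕ) (f : ι →₀ A) (b : ι) :
    (P.free d).proj j f b = if d b ≤ j then P.proj (j - d b) (f b) else 0 := rfl

lemma smul_mem_freeGrading (hmul : ∀ i j x y, x ∈ 𝒜 i → y ∈ 𝒜 j → x * y ∈ 𝒜 (i + j))
    {d : ι → ℕ} (i j : ℕ) (x : A) (f : ι →₀ A) (hx : x ∈ 𝒜 i) (hf : f ∈ freeGrading 𝒜 d j) :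
    x • f ∈ freeGrading 𝒜 d (i + j) := by
  intro b
  by_cases h : d b ≤ j
  · refine ⟨fun _ => ?_, fun h' => by omega⟩
    have := hmul i _ x _ hx ((hf b).1 h)
    rwa [← Nat.add_sub_assoc h] at this
  · simp [(hf b).2 (by omega)]

/-- A linear map from a graded free module preserves degrees if it does so on the basis. -/
lemma map_mem_of_basis {N : Type*} [AddCommGroup N] [Module A N] [Module K N]
    {𝒩 : ℕ → Submodule K N} (hsmul : ∀ i j (x : A) (y : N), x ∈ 𝒜 i → y ∈ 𝒩 j → x • y ∈ 𝒩 (i + j))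
    {d : ι → ℕ} (φ : (ι →₀ A) →ₗ[A] N) (h : ∀ b, φ (Finsupp.single b 1) ∈ 𝒩 (d b))
    (j : ℕ) (f : ι →₀ A) (hf : f ∈ freeGrading 𝒜 d j) : φ f ∈ 𝒩 j := by
  have : φ f = ∑ b ∈ f.support, f b • φ (Finsupp.single b 1) := by
    conv_lhs => rw [← Finsupp.sum_single f, Finsupp.sum, map_sum]
    refine Finset.sum_congr rfl fun b _ => ?_
    rw [← map_smul, Finsupp.smul_single, smul_eq_mul, mul_one]
  rw [this]
  refine sum_mem fun b hb => ?_
  by_cases hd : d b ≤ j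
  · have := hsmul _ _ _ _ ((hf b).1 hd) (h b)
    rwa [Nat.sub_add_cancel hd] at this
  · rw [(hf b).2 (by omega), zero_smul]; exact zero_mem _

lemma mul_mem_quotientGrading (hmul : ∀ i j x y, x ∈ 𝒜 i → y ∈ 𝒜 j → x * y ∈ 𝒜 (i + j))
    (J : Ideal A) (i j : ℕ) (x y : A ⧸ J) (hx : x ∈ quotientGrading 𝒜 J i)
    (hy : y ∈ quotientGrading 𝒜 J j) : x * y ∈ quotientGrading 𝒜 J (i + j) := by
  obtain ⟨x, hx, rfl⟩ := hx
  obtain ⟨y, hy, rfl⟩ := hy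
  exact ⟨x * y, hmul _ _ _ _ hx hy, map_mul (Ideal.Quotient.mk J) _ _⟩

lemma smul_mem_quotientGrading (hmul : ∀ i j x y, x ∈ 𝒜 i → y ∈ 𝒜 j → x * y ∈ 𝒜 (i + j))
    (J : Ideal A) (i j : ℕ) (x : A) (y : A ⧸ J) (hx : x ∈ 𝒜 i)
    (hy : y ∈ quotientGrading 𝒜 J j) : x • y ∈ quotientGrading 𝒜 J (i + j) := by
  obtain ⟨y, hy, rfl⟩ := hy
  exact ⟨x * y, hmul _ _ _ _ hx hy, map_mul (Ideal.Quotient.mk J) _ _⟩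

end Projections

/-! ### Standard graded algebras and linear resolutions -/

section StandardGraded

variable {K : Type*} [Field K] {A : Type*} [CommRing A] [Algebra K A]

/-- A standard graded `K`-algebra with irrelevant ideal `𝔪`. -/
structure StandardGraded (𝒜 : ℕ → Submodule K A) (𝔪 : Ideal A) extends HomogProj 𝒜 where
  mul_mem : ∀ i j x y, x ∈ 𝒜 i → y ∈ 𝒜 j → x * y ∈ 𝒜 (i + j)
  one_mem : (1 : A) ∈ 𝒜 0
  exists_algebraMap : ∀ {x}, x ∈ 𝒜 0 → ∃ c : K, x = algebraMap K A c
  eq_span : 𝔪 = Ideal.span (𝒜 1)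
  mem_of_pos : ∀ {j x}, 0 < j → x ∈ 𝒜 j → x ∈ 𝔪
  finite_one : Module.Finite K (𝒜 1)

/-- Koszulness with respect to the irrelevant ideal `𝔪`. -/
def IsKoszulAlgebra (𝒜 : ℕ → Submodule K A) (𝔪 : Ideal A) : Prop :=
  ∃ F : GradedFreeResolution 𝒜 𝔪, ∀ i j : ℕ, i ≠ j → F.tor 𝔪 i j = ⊥

namespace StandardGraded

variable {𝒜 : ℕ → Submodule K A} {𝔪 : Ideal A}

lemma proj_succ_smul (S : StandardGraded 𝒜 𝔪) {ι : Type*} (d : ι → ℕ) {x : A} (hx : x ∈ 𝒜 1)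
    (j : ℕ) (f : ι →₀ A) :
    (S.free d).proj (j + 1) (x • f) = x • (S.free d).proj j f := by
  have := (S.free d).map_proj_add (S.free d) (LinearMap.lsmul A (ι →₀ A) x) (d := 1)
    (fun j f hf => smul_mem_freeGrading S.mul_mem 1 j x f hx hf) j f
  rwa [add_comm] at this

/-- Linear forms have no constant part, and multiplication by `A` preserves this: degree 0 elements
are scalars, and elements of positive degree raise degrees. -/
lemma proj_zero_of_mem (S : StandardGraded 𝒜 𝔪) {x : A} (hx : x ∈ 𝔪) : S.proj 0 x = 0 := by
  rw [S.eq_span] at hx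
  induction hx using Submodule.span_induction with
  | zero => simp
  | add x y _ _ hx hy => rw [map_add, hx, hy, add_zero]
  | mem x hx => exact S.proj_ne hx one_ne_zero
  | smul r x _ hx =>
    induction r using S.induction with
    | h0 => simp
    | hadd r s hr hs => rw [add_smul, map_add, hr, hs, add_zero]
    | hmem j r hr =>
      rcases Nat.eq_zero_or_pos j with rfl | hj
      · obtain ⟨c, rfl⟩ := S.exists_algebraMap hr
        rw [algebraMap_smul, map_smul, hx, smul_zero]
      · exact S.toHomogProj.proj_eq_zero_of_lt S.toHomogProj (LinearMap.mulLeft K r) (d := j)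
          (fun k y hy => S.mul_mem j k r y hr hy) hj x

lemma eq_zero_of_mem (S : StandardGraded 𝒜 𝔪) {x : A} (hx : x ∈ 𝔪) (h0 : x ∈ 𝒜 0) : x = 0 := by
  rw [← S.proj_same h0, S.proj_zero_of_mem hx]

lemma proj_mem_ideal (S : StandardGraded 𝒜 𝔪) (x : A) (hx : x ∈ 𝔪) (j : ℕ) : S.proj j x ∈ 𝔪 := by
  rcases Nat.eq_zero_or_pos j with rfl | hj
  · rw [S.proj_zero_of_mem hx]; exact zero_mem _
  · exact S.mem_of_pos hj (S.proj_mem j x)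

lemma tmul_eq_zero {ι : Type*} (x : A ⧸ 𝔪) (f : ι →₀ A) (hf : ∀ b, f b ∈ 𝔪) :
    x ⊗ₜ[A] f = 0 := by
  obtain ⟨x, rfl⟩ := Ideal.Quotient.mk_surjective x
  rw [← Finsupp.sum_single f, Finsupp.sum, TensorProduct.tmul_sum]
  refine Finset.sum_eq_zero fun b _ => ?_
  have h1 : Finsupp.single b (f b) = f b • Finsupp.single b 1 := by
    rw [Finsupp.smul_single, smul_eq_mul, mul_one]
  rw [h1, ← TensorProduct.smul_tmul]
  have : f b • (Ideal.Quotient.mk 𝔪 x) = 0 := by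
    change Ideal.Quotient.mk 𝔪 (f b * x) = 0
    exact Ideal.Quotient.eq_zero_iff_mem.2 (Ideal.mul_mem_right _ _ (hf b))
  rw [this, TensorProduct.zero_tmul]

/-- In `x ⊗ y` of degree `j ≠ i`, either `x` has positive degree and vanishes modulo `𝔪`, or every
coordinate of `y` is zero or of positive degree and can be moved across the tensor sign. -/
lemma tensorGrading_eq_bot (S : StandardGraded 𝒜 𝔪) {ι : Type*} {i j : ℕ} (hij : i ≠ j) :
    tensorGrading (A := A) (quotientGrading 𝒜 𝔪) (freeGrading 𝒜 (fun _ : ι => i)) j = ⊥ := by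
  rw [tensorGrading, Submodule.span_eq_bot]
  rintro _ ⟨p, q, x, y, hpq, hx, hy, rfl⟩
  rcases Nat.eq_zero_or_pos p with rfl | hp
  · obtain rfl : q = j := by omega
    refine tmul_eq_zero x y fun b => ?_
    rcases lt_or_gt_of_ne hij with hlt | hlt
    · exact S.mem_of_pos (Nat.sub_pos_of_lt hlt) ((hy b).1 hlt.le)
    · rw [(hy b).2 hlt]; exact zero_mem _
  · obtain ⟨x, hx, rfl⟩ := hx
    have : (Ideal.Quotient.mkₐ K 𝔪).toLinearMap x = 0 :=
      Ideal.Quotient.eq_zero_iff_mem.2 (S.mem_of_pos hp hx)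
    rw [this, TensorProduct.zero_tmul]

/-- A linear free resolution witnesses Koszulness. -/
theorem isKoszulAlgebra_of_linear (S : StandardGraded 𝒜 𝔪) (ι : ℕ → Type)
    (D : ∀ i, (ι (i + 1) →₀ A) →ₗ[A] (ι i →₀ A)) (aug : (ι 0 →₀ A) →ₗ[A] (A ⧸ 𝔪))
    (hD : ∀ i b c, D i (Finsupp.single b 1) c ∈ 𝒜 1)
    (haug : ∀ b, aug (Finsupp.single b 1) ∈ quotientGrading 𝒜 𝔪 0)
    (hDD : ∀ i, Function.Exact (D (i + 1)) (D i)) (hD0 : Function.Exact (D 0) aug)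
    (hsurj : Function.Surjective aug) : IsKoszulAlgebra 𝒜 𝔪 := by
  refine ⟨⟨ι, fun i _ => i, D, aug, ?_, ?_, hDD, hD0, hsurj⟩, ?_⟩
  · intro i
    refine map_mem_of_basis (smul_mem_freeGrading S.mul_mem) (D i) fun b c => ?_
    refine ⟨fun _ => ?_, fun h => by omega⟩
    simpa using hD i b c
  · exact map_mem_of_basis (smul_mem_quotientGrading S.mul_mem _) aug haug
  · intro i j hij
    rw [GradedFreeResolution.tor, GradedFreeResolution.homogeneousCycles,
      S.tensorGrading_eq_bot hij, inf_bot_eq, Submodule.map_bot]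

/-- The syzygies of a graded free resolution. -/
def _root_.KoszulTransfer.GradedFreeResolution.syzygy (F : GradedFreeResolution 𝒜 𝔪) :
    ∀ i, Submodule A (F.basis i →₀ A)
  | 0 => LinearMap.ker F.aug
  | i + 1 => LinearMap.ker (F.diff i)

lemma _root_.KoszulTransfer.GradedFreeResolution.range_diff (F : GradedFreeResolution 𝒜 𝔪)
    (i : ℕ) :
    LinearMap.range (F.diff i) = F.syzygy i := by
  cases i with
  | zero => exact F.exact_aug.linearMap_ker_eq.symm
  | succ i => exact (F.exact_diff i).linearMap_ker_eq.symm

lemma mem_smul_top {ι : Type*} {f : ι →₀ A} (hf : ∀ b, f b ∈ 𝔪) :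
    f ∈ 𝔪 • (⊤ : Submodule A (ι →₀ A)) := by
  rw [← Finsupp.sum_single f]
  refine sum_mem fun b _ => ?_
  have h1 : Finsupp.single b (f b) = f b • Finsupp.single b 1 := by
    rw [Finsupp.smul_single, smul_eq_mul, mul_one]
  rw [h1]
  exact Submodule.smul_mem_smul (hf b) trivial

/-- If `Tor_{i+1}(A/𝔪, A/𝔪)_j = 0`, then an element of degree `j` of the `i`-th syzygy
module all of whose coordinates lie in `𝔪` lies in `𝔪` times the syzygy module. -/
lemma mem_smul_syzygy (S : StandardGraded 𝒜 𝔪) (F : GradedFreeResolution 𝒜 𝔪) {i j : ℕ}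
    (hF : F.tor 𝔪 (i + 1) j = ⊥)
    {z : F.basis i →₀ A} (hz : z ∈ F.syzygy i) (hzj : z ∈ freeGrading 𝒜 (F.deg i) j)
    (hzm : ∀ b, z b ∈ 𝔪) : z ∈ 𝔪 • F.syzygy i := by
  rw [← F.range_diff] at hz ⊢
  obtain ⟨y, hy⟩ := hz
  -- Tor is known to vanish only in degree `j`, so the preimage is replaced by its degree `j` part.
  set y' := (S.free (F.deg (i + 1))).proj j y with hy'_def
  have hy' : F.diff i y' = z := by
    rw [hy'_def, (S.free _).map_proj (S.free (F.deg i)) (F.diff i) (F.diff_mem i), hy,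
      (S.free _).proj_same hzj]
  have hcyc : (1 : A ⧸ 𝔪) ⊗ₜ[A] y' ∈ F.homogeneousCycles 𝔪 (i + 1) j := by
    refine ⟨?_, Submodule.subset_span ⟨0, j, 1, y', zero_add j, ⟨1, S.one_mem, rfl⟩,
      (S.free _).proj_mem _ _, rfl⟩⟩
    change F.chainDiff 𝔪 i (1 ⊗ₜ[A] y') = 0
    rw [GradedFreeResolution.chainDiff, LinearMap.lTensor_tmul, hy']
    exact tmul_eq_zero _ _ hzm
  have hb : (1 : A ⧸ 𝔪) ⊗ₜ[A] y' ∈ F.boundaries 𝔪 (i + 1) := by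
    have : (F.boundaries 𝔪 (i + 1)).mkQ (1 ⊗ₜ[A] y') ∈ F.tor 𝔪 (i + 1) j := ⟨_, hcyc, rfl⟩
    rw [hF, Submodule.mem_bot] at this
    exact (Submodule.Quotient.mk_eq_zero _).1 this
  obtain ⟨t, ht⟩ := hb
  obtain ⟨f, hf⟩ := Submodule.mkQ_surjective _ (TensorProduct.quotTensorEquivQuotSMul _ 𝔪 t)
  obtain rfl : (1 : A ⧸ 𝔪) ⊗ₜ[A] f = t := by
    rw [← TensorProduct.quotTensorEquivQuotSMul_symm_mk, ← Submodule.mkQ_apply, hf,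
      LinearEquiv.symm_apply_apply]
  rw [GradedFreeResolution.chainDiff, LinearMap.lTensor_tmul] at ht
  have ht' : y' - F.diff (i + 1) f ∈ 𝔪 • (⊤ : Submodule A (F.basis (i + 1) →₀ A)) := by
    have := congrArg (TensorProduct.quotTensorEquivQuotSMul _ 𝔪) ht
    rw [TensorProduct.quotTensorEquivQuotSMul_mk_one_tmul,
      TensorProduct.quotTensorEquivQuotSMul_mk_one_tmul] at this
    exact (Submodule.Quotient.eq _).1 this.symm
  -- The differential kills the boundary part of `y'` and sends `𝔪` times the free module into `𝔪`
  -- times the syzygies.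
  have := Submodule.mem_map_of_mem (f := F.diff i) ht'
  rwa [Submodule.map_smul'', map_sub, (F.exact_diff i).apply_apply_eq_zero, sub_zero, hy',
    Submodule.map_top] at this

end StandardGraded
end StandardGraded

/-! ### Comparison of a linear complex with a given resolution -/

section Comparison

variable {K : Type*} [Field K] {A : Type*} [CommRing A] [Algebra K A]
  {𝒜 : ℕ → Submodule K A} {𝔪 : Ideal A}

/-- The submodule `Z` of a free module on basis elements of degree `i` is stably equivalent to the
`i`-th syzygy module of `F`: there are maps `f` and `g` of the ambient free modules inducing maps
between `Z` and the syzygy module such that `1 - g ∘ f` extends to a map from the free module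
to `Z`. -/
def StablyEquivalent (F : GradedFreeResolution 𝒜 𝔪) (i : ℕ) {ι : Type*}
    (Z : Submodule A (ι →₀ A)) : Prop :=
  ∃ (f : (ι →₀ A) →ₗ[A] (F.basis i →₀ A)) (g : (F.basis i →₀ A) →ₗ[A] (ι →₀ A))
    (ρ : (ι →₀ A) →ₗ[A] (ι →₀ A)),
    (∀ j, ∀ x ∈ freeGrading 𝒜 (fun _ => i) j, f x ∈ freeGrading 𝒜 (F.deg i) j) ∧
    (∀ z ∈ Z, f z ∈ F.syzygy i) ∧ (∀ y ∈ F.syzygy i, g y ∈ Z) ∧ (∀ x, ρ x ∈ Z) ∧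
    ∀ z ∈ Z, z = g (f z) + ρ z

/-- The elements of the free module of rank one with coordinate in `𝔪`. -/
def rankOne (𝔪 : Ideal A) : Submodule A (Fin 1 →₀ A) :=
  Submodule.comap (Finsupp.lapply 0) 𝔪

lemma mem_rankOne {f : Fin 1 →₀ A} : f ∈ rankOne 𝔪 ↔ f 0 ∈ 𝔪 := Iff.rfl

lemma exists_linearMap_of_basis {M ι : Type*} [AddCommGroup M] [Module A M] (p : ι → M → Prop)
    (h : ∀ b, ∃ x, p b x) : ∃ φ : (ι →₀ A) →ₗ[A] M, ∀ b, p b (φ (Finsupp.single b 1)) := by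
  choose x hx using h
  refine ⟨Finsupp.linearCombination A x, fun b => ?_⟩
  simpa using hx b

/-- Both `A` and `F₀` are free covers of `A/𝔪`, so the identity lifts to maps `f` and `g` in both
directions. Then `1 - g ∘ f` dies in `A/𝔪`, so it has values in `𝔪`. -/
lemma StandardGraded.stablyEquivalent_rankOne (S : StandardGraded 𝒜 𝔪)
    (F : GradedFreeResolution 𝒜 𝔪) : StablyEquivalent F 0 (rankOne 𝔪) := by
  let Q := S.toHomogProj.quotient 𝔪 S.proj_mem_ideal
  obtain ⟨y, hy⟩ := F.aug_surjective 1
  obtain ⟨f, hf⟩ := exists_linearMap_of_basis (A := A) (ι := Fin 1)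
    -- Only `f` has to preserve degrees, since Tor vanishing is applied to the image of a
    -- homogeneous element under `f`; no such condition is put on `g`.
    (fun _ x => F.aug x = 1 ∧ x ∈ freeGrading 𝒜 (F.deg 0) 0) fun _ =>
      ⟨(S.free (F.deg 0)).proj 0 y, by
        rw [(S.free _).map_proj Q F.aug F.aug_mem, hy]
        exact Q.proj_same ⟨1, S.one_mem, rfl⟩, (S.free _).proj_mem _ _⟩
  obtain ⟨g, hg⟩ := exists_linearMap_of_basis (A := A) (ι := F.basis 0)
    (fun b (x : Fin 1 →₀ A) => Ideal.Quotient.mk 𝔪 (x 0) = F.aug (Finsupp.single b 1)) fun b => by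
      obtain ⟨x, hx⟩ := Ideal.Quotient.mk_surjective (F.aug (Finsupp.single b 1))
      exact ⟨Finsupp.single 0 x, by simpa using hx⟩
  have hg' : ∀ x, Ideal.Quotient.mk 𝔪 (g x 0) = F.aug x := by
    intro x
    have : (Ideal.Quotient.mkₐ A 𝔪).toLinearMap ∘ₗ Finsupp.lapply 0 ∘ₗ g = F.aug := by
      ext b; exact hg b
    exact LinearMap.congr_fun this x
  have hf' : ∀ x, F.aug (f x) = Ideal.Quotient.mk 𝔪 (x 0) := by
    intro x
    have : F.aug ∘ₗ f = (Ideal.Quotient.mkₐ A 𝔪).toLinearMap ∘ₗ Finsupp.lapply 0 := by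
      ext b
      rw [Subsingleton.elim b 0]
      simpa using (hf 0).1
    exact LinearMap.congr_fun this x
  refine ⟨f, g, LinearMap.id - g ∘ₗ f, ?_, ?_, ?_, ?_, ?_⟩
  · exact map_mem_of_basis (smul_mem_freeGrading S.mul_mem) f fun b => (hf b).2
  · intro z hz
    change F.aug (f z) = 0
    rw [hf', Ideal.Quotient.eq_zero_iff_mem]
    exact hz
  · intro y hy
    rw [mem_rankOne, ← Ideal.Quotient.eq_zero_iff_mem, hg']
    exact hy
  · intro x
    rw [mem_rankOne, ← Ideal.Quotient.eq_zero_iff_mem]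
    simp [hg', hf']
  · intro z _
    simp

/-- This is the lifting argument behind Schanuel's lemma: `f` and `g` lift to the covering free
modules, and `ρ` lifts through `D` to `s`. The new homotopy `1 - g' ∘ f' - s ∘ D` lands in the
kernel of `D`, and its last term vanishes there. -/
lemma StandardGraded.stablyEquivalent_ker (S : StandardGraded 𝒜 𝔪) {F : GradedFreeResolution 𝒜 𝔪}
    {i : ℕ} {ι κ : Type*} {Z : Submodule A (ι →₀ A)} (h : StablyEquivalent F i Z)
    (D : (κ →₀ A) →ₗ[A] (ι →₀ A)) (hD : LinearMap.range D = Z)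
    (hdeg : ∀ b, D (Finsupp.single b 1) ∈ freeGrading 𝒜 (fun _ => i) (i + 1)) :
    StablyEquivalent F (i + 1) (LinearMap.ker D) := by
  obtain ⟨f, g, ρ, hf, hfZ, hgZ, hρ, hid⟩ := h
  have hDZ : ∀ x, D x ∈ Z := fun x => hD ▸ LinearMap.mem_range_self D x
  obtain ⟨f', hf'⟩ := exists_linearMap_of_basis (A := A) (ι := κ)
    (fun b x => F.diff i x = f (D (Finsupp.single b 1)) ∧
      x ∈ freeGrading 𝒜 (F.deg (i + 1)) (i + 1)) fun b => by
      have h1 := hfZ _ (hDZ (Finsupp.single b 1))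
      rw [← F.range_diff] at h1
      obtain ⟨y, hy⟩ := h1
      refine ⟨(S.free (F.deg (i + 1))).proj (i + 1) y, ?_, (S.free _).proj_mem _ _⟩
      rw [(S.free _).map_proj (S.free (F.deg i)) (F.diff i) (F.diff_mem i), hy,
        (S.free _).proj_same (hf _ _ (hdeg b))]
  obtain ⟨g', hg'⟩ := exists_linearMap_of_basis (A := A) (ι := F.basis (i + 1))
    (fun b x => D x = g (F.diff i (Finsupp.single b 1))) fun b => by
      have h1 : g (F.diff i (Finsupp.single b 1)) ∈ LinearMap.range D := by
        rw [hD]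
        exact hgZ _ (F.range_diff i ▸ LinearMap.mem_range_self _ _)
      exact h1
  obtain ⟨s, hs⟩ := exists_linearMap_of_basis (A := A) (ι := ι)
    (fun b x => D x = ρ (Finsupp.single b 1)) fun b => by
      have h1 : ρ (Finsupp.single b 1) ∈ LinearMap.range D := hD ▸ hρ _
      exact h1
  have hf'D : ∀ x, F.diff i (f' x) = f (D x) := by
    have : F.diff i ∘ₗ f' = f ∘ₗ D := by
      ext b : 2; simpa using (hf' b).1
    exact LinearMap.congr_fun this
  have hg'D : ∀ x, D (g' x) = g (F.diff i x) := by
    have : D ∘ₗ g' = g ∘ₗ F.diff i := by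
      ext b : 2; simpa using hg' b
    exact LinearMap.congr_fun this
  have hsD : ∀ x, D (s x) = ρ x := by
    have : D ∘ₗ s = ρ := by
      ext b : 2; simpa using hs b
    exact LinearMap.congr_fun this
  refine ⟨f', g', LinearMap.id - g' ∘ₗ f' - s ∘ₗ D, ?_, ?_, ?_, ?_, ?_⟩
  · exact map_mem_of_basis (smul_mem_freeGrading S.mul_mem) f' fun b => (hf' b).2
  · intro z hz
    change F.diff i (f' z) = 0
    rw [hf'D, LinearMap.mem_ker.1 hz, map_zero]
  · intro y hy
    have : F.diff i y = 0 := hy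
    rw [LinearMap.mem_ker, hg'D, this, map_zero]
  · intro x
    rw [LinearMap.mem_ker]
    simp only [LinearMap.sub_apply, LinearMap.id_apply, LinearMap.comp_apply, map_sub, hg'D, hf'D,
      hsD]
    conv_lhs => enter [1, 1]; rw [hid _ (hDZ x)]
    abel
  · intro z hz
    simp [LinearMap.mem_ker.1 hz]

lemma mem_of_mem_smul_top {ι : Type*} {f : ι →₀ A} (hf : f ∈ 𝔪 • (⊤ : Submodule A (ι →₀ A)))
    (b : ι) : f b ∈ 𝔪 := by
  induction hf using Submodule.smul_induction_on' with
  | smul r hr n _ => exact Ideal.mul_mem_right _ _ hr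
  | add x _ y _ hx hy => exact add_mem hx hy

/-- If the `Tor` groups vanish off the diagonal, then `Z` is generated in degree `i + 1`. -/
theorem StandardGraded.le_span (S : StandardGraded 𝒜 𝔪) {F : GradedFreeResolution 𝒜 𝔪}
    (hF : ∀ i j : ℕ, i ≠ j → F.tor 𝔪 i j = ⊥) {i : ℕ} {ι : Type*} {Z : Submodule A (ι →₀ A)}
    (h : StablyEquivalent F i Z) (hZ : ∀ z ∈ Z, ∀ j, (S.free fun _ => i).proj j z ∈ Z)
    (hmin : ∀ z ∈ Z, z ∈ freeGrading 𝒜 (fun _ => i) i → z = 0) :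
    Z ≤ Submodule.span A {z | z ∈ Z ∧ z ∈ freeGrading 𝒜 (fun _ => i) (i + 1)} := by
  set N := Submodule.span A {z | z ∈ Z ∧ z ∈ freeGrading 𝒜 (fun _ => i) (i + 1)}
  obtain ⟨f, g, ρ, hf, hfZ, hgZ, hρ, hid⟩ := h
  -- In `z = g (f z) + ρ z` both summands lie in `𝔪 • Z`: the first because Tor vanishing puts `f z`
  -- into `𝔪` times the syzygies, the second because `z` has coordinates in `𝔪` and `ρ` maps the
  -- whole free module to `Z`.
  have key : ∀ j, i + 1 < j → ∀ z ∈ Z, z ∈ freeGrading 𝒜 (fun _ => i) j → z ∈ 𝔪 • Z := by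
    intro j hj z hz hzj
    have hzm : z ∈ 𝔪 • (⊤ : Submodule A (ι →₀ A)) := by
      refine mem_smul_top fun b => S.mem_of_pos (j := j - i) (by omega) ((hzj b).1 ?_)
      exact (show i ≤ j by omega)
    have hfz : f z ∈ 𝔪 • F.syzygy i := by
      refine S.mem_smul_syzygy F (hF (i + 1) j (by omega)) (hfZ z hz) (hf j z hzj) ?_
      refine mem_of_mem_smul_top ?_
      have := Submodule.mem_map_of_mem (f := f) hzm
      rw [Submodule.map_smul''] at this
      exact Submodule.smul_mono le_rfl le_top this
    rw [hid z hz]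
    refine add_mem ?_ ?_
    · have := Submodule.mem_map_of_mem (f := g) hfz
      rw [Submodule.map_smul''] at this
      refine Submodule.smul_mono le_rfl ?_ this
      exact Submodule.map_le_iff_le_comap.2 hgZ
    · have := Submodule.mem_map_of_mem (f := ρ) hzm
      rw [Submodule.map_smul''] at this
      refine Submodule.smul_mono le_rfl ?_ this
      exact Submodule.map_le_iff_le_comap.2 fun x _ => hρ x
  -- Graded Nakayama by induction on the degree: since `𝔪` is generated by linear forms, the degree
  -- `j + 1` part of `𝔪 • Z` comes from degree `j` parts of `Z`.
  have main : ∀ j, ∀ z ∈ Z, (S.free fun _ => i).proj j z ∈ N := by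
    intro j
    induction j with
    | zero =>
      intro z hz
      have h1 := (S.free fun _ : ι => i).proj_mem 0 z
      rcases Nat.eq_zero_or_pos i with rfl | hi
      · rw [hmin _ (hZ z hz 0) h1]; exact zero_mem _
      · convert zero_mem N
        ext b
        exact (h1 b).2 hi
    | succ j ih =>
      intro z hz
      have h1 := (S.free fun _ : ι => i).proj_mem (j + 1) z
      rcases lt_trichotomy j i with hj | rfl | hj
      · rcases (show j + 1 ≤ i from hj).eq_or_lt with rfl | hj'
        · rw [hmin _ (hZ z hz _) h1]; exact zero_mem _
        · convert zero_mem N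
          ext b
          exact (h1 b).2 hj'
      · exact Submodule.subset_span ⟨hZ z hz _, h1⟩
      · have h2 := key (j + 1) (by omega) _ (hZ z hz _) h1
        rw [← (S.free fun _ : ι => i).proj_same h1]
        generalize (S.free fun _ : ι => i).proj (j + 1) z = y at h2
        induction h2 using Submodule.smul_induction_on' with
        | add x _ y _ hx hy => rw [map_add]; exact add_mem hx hy
        | smul r hr n hn =>
          rw [S.eq_span] at hr
          induction hr using Submodule.span_induction generalizing n with
          | zero => rw [zero_smul, map_zero]; exact zero_mem _
          | add x y _ _ hx hy => rw [add_smul, map_add]; exact add_mem (hx n hn) (hy n hn)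
          | mem x hx =>
            rw [S.proj_succ_smul _ hx]
            exact N.smul_mem _ (ih n hn)
          | smul a x _ hx =>
            rw [smul_eq_mul, mul_comm, mul_smul]
            exact hx _ (Z.smul_mem a hn)
  exact fun z hz => (S.free fun _ => i).mem_of_proj_mem N fun j => main j z hz

end Comparison

/-! ### Lifting a linear resolution along a degeneration -/

section Degeneration

variable {K : Type*} [Field K] {A B : Type*} [CommRing A] [Algebra K A] [CommRing B] [Algebra K B]

/-- A degeneration of a standard graded algebra `A` to its associated graded algebra `B` with
respect to a filtration by a weight.  The pair `(x, y)` lies in `rel k` if `x` has weight at most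
`k` and `y` is the class of `x` modulo elements of smaller weight. -/
structure Degeneration (𝒜 : ℕ → Submodule K A) (𝔪 : Ideal A) (ℬ 𝒲 : ℕ → Submodule K B)
    (𝔫 : Ideal B) where
  stdA : StandardGraded 𝒜 𝔪
  stdB : StandardGraded ℬ 𝔫
  weight : HomogProj 𝒲
  weight_mul : ∀ i j x y, x ∈ 𝒲 i → y ∈ 𝒲 j → x * y ∈ 𝒲 (i + j)
  weight_proj_mem : ∀ i j x, x ∈ ℬ j → weight.proj i x ∈ ℬ j
  /-- the relation between elements of weight at most `k` and their symbols -/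
  rel : ℕ → Submodule K (A × B)
  mul_mem : ∀ {k l x y x' y'}, (x, y) ∈ rel k → (x', y') ∈ rel l → (x * x', y * y') ∈ rel (k + l)
  symbol_eq_zero : ∀ {k y}, (0, y) ∈ rel k → y = 0
  eq_zero_of_rel_zero : ∀ {x}, (x, 0) ∈ rel 0 → x = 0
  lower : ∀ {k x}, (x, 0) ∈ rel (k + 1) → ∃ y, (x, y) ∈ rel k
  raise : ∀ {k l x y}, (x, y) ∈ rel k → k < l → (x, 0) ∈ rel l
  exists_rel_of_symbol : ∀ {k y}, y ∈ 𝒲 k → ∃ x, (x, y) ∈ rel k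
  exists_rel : ∀ x, ∃ k y, (x, y) ∈ rel k
  symbol_mem : ∀ {k x y}, (x, y) ∈ rel k → y ∈ 𝒲 k
  proj_mem : ∀ {k x y}, (x, y) ∈ rel k → ∀ j, (stdA.proj j x, stdB.proj j y) ∈ rel k
  -- The last two conditions make `𝔫` the ideal of symbols of `𝔪`, which starts the induction on
  -- syzygies.
  symbol_mem_ideal : ∀ {k x y}, (x, y) ∈ rel k → x ∈ 𝔪 → y ∈ 𝔫
  exists_rel_ideal : ∀ {k y}, y ∈ 𝔫 → y ∈ 𝒲 k → ∃ x ∈ 𝔪, (x, y) ∈ rel k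

namespace Degeneration

variable {𝒜 : ℕ → Submodule K A} {𝔪 : Ideal A} {ℬ 𝒲 : ℕ → Submodule K B} {𝔫 : Ideal B}
  (R : Degeneration 𝒜 𝔪 ℬ 𝒲 𝔫) {ι κ : Type*}

/-- The symbol relation on free modules whose basis elements have weights `w`. -/
def freeRel (w : ι → ℕ) (k : ℕ) : Submodule K ((ι →₀ A) × (ι →₀ B)) where
  carrier := {p | ∀ b, (w b ≤ k → (p.1 b, p.2 b) ∈ R.rel (k - w b)) ∧
    (k < w b → p.1 b = 0 ∧ p.2 b = 0)}
  zero_mem' := fun b => ⟨fun _ => zero_mem _, fun _ => ⟨rfl, rfl⟩⟩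
  add_mem' := fun {f g} hf hg b =>
    ⟨fun h => add_mem ((hf b).1 h) ((hg b).1 h),
      fun h => by simp [(hf b).2 h, (hg b).2 h]⟩
  smul_mem' := fun c f hf b =>
    ⟨fun h => Submodule.smul_mem _ c ((hf b).1 h), fun h => by simp [(hf b).2 h]⟩

variable {R} {w : ι → ℕ} {w' : κ → ℕ}

lemma mem_freeRel {k : ℕ} {x : ι →₀ A} {y : ι →₀ B} : (x, y) ∈ R.freeRel w k ↔
    ∀ b, (w b ≤ k → (x b, y b) ∈ R.rel (k - w b)) ∧ (k < w b → x b = 0 ∧ y b = 0) := Iff.rfl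

lemma smul_mem_freeRel {k l : ℕ} {a : A} {c : B} {x : ι →₀ A} {y : ι →₀ B}
    (h : (a, c) ∈ R.rel k) (h' : (x, y) ∈ R.freeRel w l) :
    (a • x, c • y) ∈ R.freeRel w (k + l) := by
  rw [mem_freeRel] at h' ⊢
  intro b
  by_cases hb : w b ≤ l
  · refine ⟨fun _ => ?_, fun h => by omega⟩
    have := R.mul_mem h ((h' b).1 hb)
    rwa [← Nat.add_sub_assoc hb] at this
  · have := (h' b).2 (by omega)
    simp only [Finsupp.smul_apply, this.1, this.2, smul_zero]
    exact ⟨fun _ => zero_mem _, fun _ => ⟨trivial, trivial⟩⟩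

lemma freeRel_symbol_eq_zero {k : ℕ} {y : ι →₀ B} (h : (0, y) ∈ R.freeRel w k) : y = 0 := by
  ext b
  by_cases hb : w b ≤ k
  · exact R.symbol_eq_zero ((h b).1 hb)
  · exact ((h b).2 (by omega)).2

lemma freeRel_symbol_mem {k : ℕ} {x : ι →₀ A} {y : ι →₀ B} (h : (x, y) ∈ R.freeRel w k) :
    y ∈ freeGrading 𝒲 w k :=
  fun b => ⟨fun hb => R.symbol_mem ((h b).1 hb), fun hb => ((h b).2 hb).2⟩

lemma freeRel_eq_zero {x : ι →₀ A} (h : (x, 0) ∈ R.freeRel w 0) : x = 0 := by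
  ext b
  by_cases hb : w b ≤ 0
  · refine R.eq_zero_of_rel_zero ?_
    have := (h b).1 hb
    rwa [Nat.zero_sub] at this
  · exact ((h b).2 (by omega)).1

lemma freeRel_lower [Finite ι] {k : ℕ} {x : ι →₀ A} (h : (x, 0) ∈ R.freeRel w (k + 1)) :
    ∃ y, (x, y) ∈ R.freeRel w k := by
  have : ∀ b, ∃ y, (w b ≤ k → (x b, y) ∈ R.rel (k - w b)) ∧ (k < w b → x b = 0 ∧ y = 0) := by
    intro b
    rcases lt_trichotomy (w b) (k + 1) with hb | hb | hb
    · have := (h b).1 hb.le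
      rw [show k + 1 - w b = (k - w b) + 1 by omega] at this
      obtain ⟨y, hy⟩ := R.lower this
      exact ⟨y, fun _ => hy, fun h => by omega⟩
    -- Here the coordinate has weight at most 0 and zero symbol, so it vanishes, as membership in
    -- weight `k < w b` demands.
    · have := (h b).1 hb.le
      rw [hb, Nat.sub_self] at this
      exact ⟨0, fun h => by omega, fun _ => ⟨R.eq_zero_of_rel_zero this, rfl⟩⟩
    · exact ⟨0, fun h => by omega, fun _ => ⟨((h b).2 hb).1, rfl⟩⟩
  choose y hy using this
  exact ⟨Finsupp.equivFunOnFinite.symm y, hy⟩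

lemma exists_freeRel [Finite ι] (x : ι →₀ A) : ∃ k y, (x, y) ∈ R.freeRel w k := by
  cases nonempty_fintype ι
  have : ∀ b, ∃ k, ∀ l, k ≤ l → w b ≤ l ∧ (x b, 0) ∈ R.rel (l - w b) := by
    intro b
    obtain ⟨k, y, h⟩ := R.exists_rel (x b)
    -- Going strictly above the weight of each coordinate makes its symbol zero, so a common bound
    -- works with symbol 0.
    exact ⟨k + w b + 1, fun l hl => ⟨by omega, R.raise h (by omega)⟩⟩
  choose k hk using this
  refine ⟨Finset.univ.sup k, 0, fun b => ?_⟩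
  have := hk b _ (Finset.le_sup (Finset.mem_univ b))
  exact ⟨fun _ => this.2, fun h => absurd this.1 (by omega)⟩

lemma freeRel_raise {k : ℕ} {x : ι →₀ A} {y : ι →₀ B} (h : (x, y) ∈ R.freeRel w k) :
    (x, 0) ∈ R.freeRel w (k + 1) := by
  rw [mem_freeRel] at h ⊢
  intro b
  by_cases hb : w b ≤ k
  · exact ⟨fun _ => R.raise ((h b).1 hb) (by omega), fun h => by omega⟩
  · rw [((h b).2 (by omega)).1]
    exact ⟨fun _ => zero_mem _, fun _ => ⟨rfl, rfl⟩⟩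

lemma freeRel_proj {k : ℕ} {x : ι →₀ A} {y : ι →₀ B} (h : (x, y) ∈ R.freeRel w k) (i j : ℕ) :
    ((R.stdA.free fun _ => i).proj j x, (R.stdB.free fun _ => i).proj j y) ∈ R.freeRel w k := by
  rw [mem_freeRel]
  intro b
  rw [HomogProj.free_proj_apply, HomogProj.free_proj_apply]
  by_cases hj : i ≤ j
  · rw [if_pos hj, if_pos hj]
    exact ⟨fun hb => R.proj_mem ((h b).1 hb) _, fun hb => by simp [(h b).2 hb]⟩
  · rw [if_neg hj, if_neg hj]
    exact ⟨fun _ => zero_mem _, fun _ => ⟨rfl, rfl⟩⟩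

lemma exists_freeRel_of_mem [Finite ι]
    {k : ℕ}
    {y : ι →₀ B} (hy : y ∈ freeGrading 𝒲 w k) : ∃ x, (x, y) ∈ R.freeRel w k := by
  have : ∀ b, ∃ x, (w b ≤ k → (x, y b) ∈ R.rel (k - w b)) ∧ (k < w b → x = 0 ∧ y b = 0) := by
    intro b
    by_cases hb : w b ≤ k
    · obtain ⟨x, hx⟩ := R.exists_rel_of_symbol ((hy b).1 hb)
      exact ⟨x, fun _ => hx, fun h => by omega⟩
    · exact ⟨0, fun h => absurd h hb, fun h => ⟨rfl, (hy b).2 h⟩⟩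
  choose x hx using this
  exact ⟨Finsupp.equivFunOnFinite.symm x, hx⟩

lemma map_eq_sum [Fintype κ] {M : Type*} [AddCommGroup M] [Module A M] (D : (κ →₀ A) →ₗ[A] M)
    (x : κ →₀ A) : D x = ∑ b, x b • D (Finsupp.single b 1) := by
  conv_lhs => rw [← Finsupp.univ_sum_single x, map_sum]
  refine Finset.sum_congr rfl fun b _ => ?_
  rw [← map_smul, Finsupp.smul_single, smul_eq_mul, mul_one]

lemma freeRel_map [Finite κ] {DA : (κ →₀ A) →ₗ[A] (ι →₀ A)} {DB : (κ →₀ B) →ₗ[B] (ι →₀ B)}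
    (h : ∀ b, (DA (Finsupp.single b 1), DB (Finsupp.single b 1)) ∈ R.freeRel w (w' b))
    {k : ℕ} {x : κ →₀ A} {y : κ →₀ B} (hxy : (x, y) ∈ R.freeRel w' k) :
    (DA x, DB y) ∈ R.freeRel w k := by
  cases nonempty_fintype κ
  have : (DA x, DB y) = ∑ b, (x b • DA (Finsupp.single b 1), y b • DB (Finsupp.single b 1)) := by
    rw [Prod.ext_iff, Prod.fst_sum, Prod.snd_sum]
    exact ⟨map_eq_sum DA x, map_eq_sum DB y⟩
  rw [this]
  refine sum_mem fun b _ => ?_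
  by_cases hb : w' b ≤ k
  · have := smul_mem_freeRel ((hxy b).1 hb) (h b)
    rwa [Nat.sub_add_cancel hb] at this
  · have := (hxy b).2 (by omega)
    simp only at this
    rw [this.1, this.2, zero_smul, zero_smul]
    exact zero_mem _

/-- Strict surjectivity of a filtered map whose symbol is surjective. -/
lemma exists_freeRel_preimage [Finite ι] [Finite κ]
    {DA : (κ →₀ A) →ₗ[A] (ι →₀ A)} {DB : (κ →₀ B) →ₗ[B] (ι →₀ B)}
    (h : ∀ b, (DA (Finsupp.single b 1), DB (Finsupp.single b 1)) ∈ R.freeRel w (w' b))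
    {ZA : Submodule A (ι →₀ A)} (hA : ∀ x, DA x ∈ ZA)
    (hsym : ∀ k x y, x ∈ ZA → (x, y) ∈ R.freeRel w k → y ∈ LinearMap.range DB) :
    ∀ k x y, x ∈ ZA → (x, y) ∈ R.freeRel w k → ∃ x' y', (x', y') ∈ R.freeRel w' k ∧ DA x' = x := by
  -- Lifting a preimage of the symbol `y` cancels the leading part of `x`; the remainder has smaller
  -- weight, or is zero when `k = 0`.
  have step : ∀ k x y, x ∈ ZA → (x, y) ∈ R.freeRel w k →
      ∃ x' y', (x', y') ∈ R.freeRel w' k ∧ (x - DA x', 0) ∈ R.freeRel w k := by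
    intro k x y hx hxy
    obtain ⟨z, hz⟩ := hsym k x y hx hxy
    have hz' : DB ((R.weight.free w').proj k z) = y := by
      rw [(R.weight.free _).map_proj (R.weight.free w) DB
        (map_mem_of_basis (smul_mem_freeGrading R.weight_mul) DB
          fun b => freeRel_symbol_mem (h b)), hz, HomogProj.proj_same _ (freeRel_symbol_mem hxy)]
    obtain ⟨x', hx'⟩ := exists_freeRel_of_mem (R := R) ((R.weight.free w').proj_mem k z)
    refine ⟨x', _, hx', ?_⟩
    have := sub_mem hxy (freeRel_map h hx')
    rwa [hz', Prod.mk_sub_mk, sub_self] at this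
  intro k
  induction k with
  | zero =>
    intro x y hx hxy
    obtain ⟨x', y', h1, h2⟩ := step 0 x y hx hxy
    exact ⟨x', y', h1, (sub_eq_zero.1 (freeRel_eq_zero h2)).symm⟩
  | succ k ih =>
    intro x y hx hxy
    obtain ⟨x', y', h1, h2⟩ := step (k + 1) x y hx hxy
    obtain ⟨y₁, hy₁⟩ := freeRel_lower h2
    obtain ⟨x'', y'', h3, h4⟩ := ih _ _ (sub_mem hx (hA x')) hy₁
    -- The correction `x''` has weight at most `k`, so it contributes symbol 0 in weight `k + 1`.
    refine ⟨x' + x'', y' + 0, add_mem h1 (freeRel_raise h3), ?_⟩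
    rw [map_add, h4]
    abel

end Degeneration
end Degeneration

/-! ### Simultaneous construction of the syzygies over a ring and its degeneration -/

section Transfer

variable {K : Type*} [Field K] {A B : Type*} [CommRing A] [Algebra K A] [CommRing B] [Algebra K B]
  {𝒜 : ℕ → Submodule K A} {𝔪 : Ideal A} {ℬ 𝒲 : ℕ → Submodule K B} {𝔫 : Ideal B}

/-- Compatible `i`-th syzygy modules `ZA` and `ZB` of the residue field over `A` and over its
degeneration `B`. -/
structure Degeneration.Stage (R : Degeneration 𝒜 𝔪 ℬ 𝒲 𝔫) (F : GradedFreeResolution ℬ 𝔫)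
    (i : ℕ) where
  /-- the rank of the ambient free modules -/
  rank : ℕ
  /-- the weights of the basis elements -/
  w : Fin rank → ℕ
  /-- the syzygy module over `A` -/
  ZA : Submodule A (Fin rank →₀ A)
  /-- the syzygy module over `B` -/
  ZB : Submodule B (Fin rank →₀ B)
  projA_mem : ∀ z ∈ ZA, ∀ j, (R.stdA.free fun _ => i).proj j z ∈ ZA
  projB_mem : ∀ z ∈ ZB, ∀ j, (R.stdB.free fun _ => i).proj j z ∈ ZB
  weight_mem : ∀ z ∈ ZB, ∀ k, (R.weight.free w).proj k z ∈ ZB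
  minimal : ∀ z ∈ ZB, z ∈ freeGrading ℬ (fun _ => i) i → z = 0
  -- With the next condition: the weight-homogeneous elements of `ZB` are exactly the symbols of
  -- elements of `ZA`.
  symbol_mem : ∀ {k x y}, x ∈ ZA → (x, y) ∈ R.freeRel w k → y ∈ ZB
  exists_rel : ∀ {k y}, y ∈ ZB → y ∈ freeGrading 𝒲 w k → ∃ x ∈ ZA, (x, y) ∈ R.freeRel w k
  stab : StablyEquivalent F i ZB

/-- The components of degree `i + 1` in the free module on generators of degree `i` are
finite-dimensional. -/
lemma StandardGraded.finite_freeGrading (S : StandardGraded 𝒜 𝔪) {ι : Type*} [Finite ι] (i : ℕ) :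
    Module.Finite K (freeGrading 𝒜 (fun _ : ι => i) (i + 1)) := by
  have := S.finite_one
  let φ : freeGrading 𝒜 (fun _ : ι => i) (i + 1) →ₗ[K] (ι → 𝒜 1) :=
    { toFun := fun f b => ⟨f.1 b, by simpa using (f.2 b).1 (Nat.le_succ i)⟩
      map_add' := fun _ _ => rfl
      map_smul' := fun _ _ => rfl }
  refine Module.Finite.of_injective φ fun f g h => ?_
  ext b
  exact congrArg Subtype.val (congrFun h b)

/-- Choosing the basis inside `T` keeps its vectors weight-homogeneous in the application, and hence
liftable. -/
lemma exists_basis_of_finite {M : Type*} [AddCommGroup M] [Module K M] (V : Submodule K M)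
    [Module.Finite K V] (T : Set M) (hT : T ⊆ V) : ∃ (m : ℕ) (v : Fin m → M), (∀ b, v b ∈ T) ∧
      LinearIndependent K v ∧ T ⊆ Submodule.span K (Set.range v) := by
  obtain ⟨s, hsT, hspan, hli⟩ := exists_linearIndependent K T
  have hli' : LinearIndependent K (fun x : s => (⟨x.1, hT (hsT x.2)⟩ : V)) :=
    LinearIndependent.of_comp V.subtype hli
  have := hli'.finite
  let e := (Finite.equivFin s).symm
  refine ⟨_, fun b => (e b).1, fun b => hsT (e b).2, hli.comp e e.injective, ?_⟩
  have : Set.range (fun b => (e b).1) = s := by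
    have h := e.surjective.range_comp (Subtype.val : s → M)
    rw [Subtype.range_val] at h
    exact h
  rw [this, hspan]
  exact Submodule.subset_span

theorem Degeneration.Stage.exists_next {R : Degeneration 𝒜 𝔪 ℬ 𝒲 𝔫} {F : GradedFreeResolution ℬ 𝔫}
    (hF : ∀ i j : ℕ, i ≠ j → F.tor 𝔫 i j = ⊥) {i : ℕ} (s : R.Stage F i) :
    ∃ (s' : R.Stage F (i + 1)) (D : (Fin s'.rank →₀ A) →ₗ[A] (Fin s.rank →₀ A)),
      LinearMap.range D = s.ZA ∧ LinearMap.ker D = s'.ZA ∧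
      ∀ b c, D (Finsupp.single b 1) c ∈ 𝒜 1 := by
  obtain ⟨m, w, ZA, ZB, hpA, hpB, hpW, hmin, hsym, hlift, hstab⟩ := s
  dsimp only
  let G := freeGrading ℬ (fun _ : Fin m => i) (i + 1)
  -- The generators must be linear and also weight-homogeneous, since only weight-homogeneous
  -- elements arise as symbols.
  let T : Set (Fin m →₀ B) := {z | (z ∈ ZB ∧ z ∈ G) ∧ ∃ k, z ∈ freeGrading 𝒲 w k}
  have := R.stdB.finite_freeGrading (ι := Fin m) i
  obtain ⟨r, v, hvT, hvli, hvspan⟩ := exists_basis_of_finite G T fun z hz => hz.1.2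
  have hlift' : ∀ b, ∃ k, ∃ x, x ∈ ZA ∧ x ∈ freeGrading 𝒜 (fun _ : Fin m => i) (i + 1) ∧
      (x, v b) ∈ R.freeRel w k := by
    intro b
    obtain ⟨⟨h1, h2⟩, k, h3⟩ := hvT b
    obtain ⟨x, hx, hxv⟩ := hlift h1 h3
    refine ⟨k, (R.stdA.free fun _ => i).proj (i + 1) x, hpA x hx _, HomogProj.proj_mem _ _ _, ?_⟩
    have := freeRel_proj hxv i (i + 1)
    rwa [(R.stdB.free fun _ => i).proj_same h2] at this
  choose w' x hxZ hxdeg hxv using hlift'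
  let DA : (Fin r →₀ A) →ₗ[A] (Fin m →₀ A) := Finsupp.linearCombination A x
  let DB : (Fin r →₀ B) →ₗ[B] (Fin m →₀ B) := Finsupp.linearCombination B v
  have hDA1 : ∀ b, DA (Finsupp.single b 1) = x b := fun b => by simp [DA]
  have hDB1 : ∀ b, DB (Finsupp.single b 1) = v b := fun b => by simp [DB]
  have hrel : ∀ b, (DA (Finsupp.single b 1), DB (Finsupp.single b 1)) ∈ R.freeRel w (w' b) := by
    intro b; rw [hDA1, hDB1]; exact hxv b
  have hDA : ∀ y, DA y ∈ ZA := by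
    intro y
    rw [map_eq_sum DA]
    exact sum_mem fun b _ => ZA.smul_mem _ (hDA1 b ▸ hxZ b)
  -- Tor vanishing gives generation in degree `i + 1`; weight components of such elements remain in
  -- that degree and in `ZB`, so they lie in the `K`-span of the chosen basis.
  have hrangeB : LinearMap.range DB = ZB := by
    rw [Finsupp.range_linearCombination]
    refine le_antisymm (Submodule.span_le.2 ?_) ?_
    · rintro _ ⟨b, rfl⟩; exact (hvT b).1.1
    · refine (R.stdB.le_span hF hstab hpB hmin).trans (Submodule.span_le.2 ?_)
      rintro z ⟨hz, hzG⟩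
      refine (R.weight.free w).mem_of_proj_mem _ fun k => ?_
      have h1 : (R.weight.free w).proj k z ∈ T := by
        refine ⟨⟨hpW z hz k, fun b => ⟨fun hb => ?_, fun hb => ?_⟩⟩, k, HomogProj.proj_mem _ _ _⟩
        · rw [HomogProj.free_proj_apply]
          split_ifs
          · exact R.weight_proj_mem _ _ _ ((hzG b).1 hb)
          · exact zero_mem _
        · exact absurd (show i + 1 < i from hb) (by omega)
      exact Submodule.span_le_restrictScalars K B _ (hvspan h1)
  have hdegB : ∀ b, DB (Finsupp.single b 1) ∈ freeGrading ℬ (fun _ => i) (i + 1) :=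
    fun b => by rw [hDB1]; exact (hvT b).1.2
  have hdegA : ∀ b, DA (Finsupp.single b 1) ∈ freeGrading 𝒜 (fun _ => i) (i + 1) :=
    fun b => by rw [hDA1]; exact hxdeg b
  have hpre := exists_freeRel_preimage hrel hDA fun k x y hx hxy => by
    rw [hrangeB]; exact hsym hx hxy
  refine ⟨⟨r, w', LinearMap.ker DA, LinearMap.ker DB, ?_, ?_, ?_, ?_, ?_, ?_,
    R.stdB.stablyEquivalent_ker hstab DB hrangeB hdegB⟩, DA, ?_, rfl, ?_⟩
  · intro z hz j
    rw [LinearMap.mem_ker, HomogProj.map_proj _ (R.stdA.free fun _ => i) DA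
      (map_mem_of_basis (smul_mem_freeGrading R.stdA.mul_mem) DA hdegA), LinearMap.mem_ker.1 hz,
      map_zero]
  · intro z hz j
    rw [LinearMap.mem_ker, HomogProj.map_proj _ (R.stdB.free fun _ => i) DB
      (map_mem_of_basis (smul_mem_freeGrading R.stdB.mul_mem) DB hdegB), LinearMap.mem_ker.1 hz,
      map_zero]
  · intro z hz j
    rw [LinearMap.mem_ker, HomogProj.map_proj _ (R.weight.free w) DB
      (map_mem_of_basis (smul_mem_freeGrading R.weight_mul) DB
        fun b => freeRel_symbol_mem (hrel b)), LinearMap.mem_ker.1 hz, map_zero]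
  -- A kernel element of degree `i + 1` has scalar coordinates, so it is a `K`-linear relation among
  -- the independent `v b`.
  · intro z hz hz0
    have hc : ∀ b, ∃ c : K, z b = algebraMap K B c := by
      intro b
      refine R.stdB.exists_algebraMap ?_
      simpa using (hz0 b).1 le_rfl
    choose c hc using hc
    have hsum : ∑ b, c b • v b = 0 := by
      rw [← LinearMap.mem_ker.1 hz, map_eq_sum DB]
      refine Finset.sum_congr rfl fun b _ => ?_
      rw [hDB1, hc, algebraMap_smul]
    have := Fintype.linearIndependent_iff.1 hvli c hsum
    ext b
    rw [hc, this, map_zero, Finsupp.zero_apply]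
  · intro k y z hy hyz
    have := freeRel_map hrel hyz
    rw [LinearMap.mem_ker.1 hy] at this
    exact freeRel_symbol_eq_zero this
  -- A lift `x₀` of `y` need not lie in the kernel, but `DA x₀` has zero symbol and hence smaller
  -- weight. By strictness it is the image of some `x'` of smaller weight, and `x₀ - x'` is in the
  -- kernel with the same symbol `y`. In weight 0 already `DA x₀ = 0`.
  · intro k y hy hyk
    obtain ⟨x₀, hx₀⟩ := exists_freeRel_of_mem (R := R) hyk
    have h1 := freeRel_map hrel hx₀
    rw [LinearMap.mem_ker.1 hy] at h1
    cases k with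
    | zero => exact ⟨x₀, freeRel_eq_zero h1, hx₀⟩
    | succ k =>
      obtain ⟨y₁, hy₁⟩ := freeRel_lower h1
      obtain ⟨x', y', h2, h3⟩ := hpre _ _ _ (hDA x₀) hy₁
      refine ⟨x₀ - x', ?_, ?_⟩
      · rw [LinearMap.mem_ker, map_sub, h3, sub_self]
      · have := sub_mem hx₀ (freeRel_raise h2)
        rwa [Prod.mk_sub_mk, sub_zero] at this
  · refine le_antisymm ?_ fun y hy => ?_
    · rintro _ ⟨y, rfl⟩; exact hDA y
    · obtain ⟨k, z, h⟩ := exists_freeRel (R := R) (w := w) y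
      obtain ⟨x', -, -, h'⟩ := hpre k y z hy h
      exact ⟨x', h'⟩
  · intro b c
    simpa using (hdegA b c).1 (Nat.le_succ i)

/-- The augmentation of the free module of rank one. -/
def rankOneAug (𝔪 : Ideal A) : (Fin 1 →₀ A) →ₗ[A] A ⧸ 𝔪 :=
  (Ideal.Quotient.mkₐ A 𝔪).toLinearMap ∘ₗ Finsupp.lapply 0

lemma rankOneAug_single (b : Fin 1) (x : A) :
    rankOneAug 𝔪 (Finsupp.single b x) = Ideal.Quotient.mk 𝔪 x := by
  rw [Subsingleton.elim b 0]
  simp [rankOneAug]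

lemma ker_rankOneAug : LinearMap.ker (rankOneAug 𝔪) = rankOne 𝔪 := by
  ext x
  exact Ideal.Quotient.eq_zero_iff_mem

lemma rankOneAug_surjective : Function.Surjective (rankOneAug 𝔪) := by
  intro x
  obtain ⟨x, rfl⟩ := Ideal.Quotient.mk_surjective x
  exact ⟨_, rankOneAug_single 0 x⟩

/-- The initial stage. -/
def Degeneration.initialStage (R : Degeneration 𝒜 𝔪 ℬ 𝒲 𝔫) (F : GradedFreeResolution ℬ 𝔫) :
    R.Stage F 0 where
  rank := 1
  w := 0
  ZA := rankOne 𝔪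
  ZB := rankOne 𝔫
  projA_mem z hz j := R.stdA.proj_mem_ideal _ hz _
  projB_mem z hz j := R.stdB.proj_mem_ideal _ hz _
  weight_mem z hz k := by
    obtain ⟨c, hc⟩ := R.stdB.exists_sum_range (z 0)
    change R.weight.proj k (z 0) ∈ 𝔫
    rw [← hc c le_rfl, map_sum]
    refine sum_mem fun j _ => ?_
    rcases Nat.eq_zero_or_pos j with rfl | hj
    · rw [R.stdB.proj_zero_of_mem (mem_rankOne.1 hz), map_zero]; exact zero_mem _
    · exact R.stdB.mem_of_pos hj (R.weight_proj_mem _ _ _ (R.stdB.proj_mem j _))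
  minimal z hz h := by
    ext
    exact R.stdB.eq_zero_of_mem hz ((h 0).1 le_rfl)
  symbol_mem {k x y} hx hxy := R.symbol_mem_ideal ((hxy 0).1 (Nat.zero_le _)) hx
  exists_rel {k y} hy hyk := by
    obtain ⟨x, hx, hxy⟩ := R.exists_rel_ideal hy ((hyk 0).1 (Nat.zero_le _))
    refine ⟨Finsupp.single 0 x, by simpa [mem_rankOne] using hx, fun b => ?_⟩
    rw [Subsingleton.elim b 0]
    simpa using hxy
  stab := R.stdB.stablyEquivalent_rankOne F

/-- Koszulness of the associated graded algebra implies Koszulness. -/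
theorem Degeneration.isKoszulAlgebra (R : Degeneration 𝒜 𝔪 ℬ 𝒲 𝔫) (h : IsKoszulAlgebra ℬ 𝔫) :
    IsKoszulAlgebra 𝒜 𝔪 := by
  obtain ⟨F, hF⟩ := h
  choose next D hrange hker hdeg using fun i (s : R.Stage F i) => s.exists_next hF
  let s : ∀ i, R.Stage F i := fun i => Nat.rec (R.initialStage F) next i
  refine R.stdA.isKoszulAlgebra_of_linear (fun i => Fin (s i).rank) (fun i => D i (s i))
    (rankOneAug 𝔪) (fun i => hdeg i (s i)) (fun b => ?_) (fun i => ?_) ?_ rankOneAug_surjective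
  · exact ⟨1, R.stdA.one_mem, (rankOneAug_single b 1).symm⟩
  · rw [LinearMap.exact_iff, hrange]
    exact hker i (s i)
  · exact LinearMap.exact_iff.2 (ker_rankOneAug.trans (hrange 0 (s 0)).symm)

end Transfer

/-! ### Quotients of polynomial rings -/

section Polynomial

open MvPolynomial

variable {K : Type*} [Field K] {n : ℕ}

/-- The projections of the polynomial ring onto weighted homogeneous components. -/
def weightProj (K : Type*) [Field K] {n : ℕ} (a : Fin n → ℕ) :
    HomogProj (weightedHomogeneousSubmodule K a) where
  proj := weightedHomogeneousComponent a
  proj_same hx := IsWeightedHomogeneous.weightedHomogeneousComponent_same hx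
  proj_ne hx h := IsWeightedHomogeneous.weightedHomogeneousComponent_ne _ hx h.symm
  mem_iSup x := by
    induction x using MvPolynomial.induction_on' with
    | monomial m c =>
      exact Submodule.mem_iSup_of_mem _ (isWeightedHomogeneous_monomial a m c rfl)
    | add p q hp hq => exact add_mem hp hq

/-- The projections of the polynomial ring onto homogeneous components. -/
def stdProj (K : Type*) [Field K] (n : ℕ) : HomogProj (homogeneousSubmodule (Fin n) K) where
  proj := homogeneousComponent
  proj_same hx := (weightProj K (1 : Fin n → ℕ)).proj_same hx
  proj_ne hx h := (weightProj K (1 : Fin n → ℕ)).proj_ne hx h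
  mem_iSup := (weightProj K (1 : Fin n → ℕ)).mem_iSup

/-- `I` is graded with respect to the standard grading. -/
def IsStdGraded (I : Ideal (MvPolynomial (Fin n) K)) : Prop :=
  ∀ f ∈ I, ∀ j : ℕ, homogeneousComponent j f ∈ I

variable {I : Ideal (MvPolynomial (Fin n) K)}

lemma mem_maximalIdeal_of_coeff_zero {f : MvPolynomial (Fin n) K} (hf : coeff 0 f = 0) :
    Ideal.Quotient.mk I f ∈ maximalIdeal I := by
  refine Ideal.mem_map_of_mem _ ?_
  rw [← Set.image_univ, mem_ideal_span_X_image]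
  intro m hm
  by_contra! h
  have : m = 0 := by ext i; exact h i (Set.mem_univ i)
  exact (mem_support_iff.1 hm) (this ▸ hf)

lemma maximalIdeal_eq_span (I : Ideal (MvPolynomial (Fin n) K)) :
    maximalIdeal I = Ideal.span (Set.range fun t => Ideal.Quotient.mk I (X t)) := by
  rw [maximalIdeal, Ideal.map_span, ← Set.range_comp]
  rfl

lemma var_mem (I : Ideal (MvPolynomial (Fin n) K)) (t : Fin n) :
    Ideal.Quotient.mk I (X t) ∈ standardGrading I 1 :=
  mk_mem_quotientGrading (isHomogeneous_X K t)

lemma mem_maximalIdeal_of_pos {j : ℕ} (hj : 0 < j) {x : MvPolynomial (Fin n) K ⧸ I}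
    (hx : x ∈ standardGrading I j) : x ∈ maximalIdeal I := by
  obtain ⟨f, hf, rfl⟩ := hx
  refine mem_maximalIdeal_of_coeff_zero (IsHomogeneous.coeff_eq_zero hf ?_)
  simpa using hj.ne

/-- The quotient of a polynomial ring by a graded ideal is standard graded. -/
def IsStdGraded.standardGraded (hI : IsStdGraded I) :
    StandardGraded (standardGrading I) (maximalIdeal I) where
  toHomogProj := (stdProj K n).quotient I hI
  mul_mem := mul_mem_quotientGrading (fun _ _ _ _ hx hy => IsHomogeneous.mul hx hy) I
  one_mem := mk_mem_quotientGrading (isHomogeneous_one _ _)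
  exists_algebraMap := by
    rintro _ ⟨f, hf, rfl⟩
    have hf' : f = C (coeff 0 f) :=
      totalDegree_eq_zero_iff_eq_C.1 ((totalDegree_zero_iff_isHomogeneous _).2 hf)
    refine ⟨coeff 0 f, ?_⟩
    conv_lhs => rw [hf']
    rfl
  eq_span := by
    refine le_antisymm ?_ (Ideal.span_le.2 fun x hx => mem_maximalIdeal_of_pos one_pos hx)
    rw [maximalIdeal_eq_span]
    refine Ideal.span_mono ?_
    rintro _ ⟨t, rfl⟩
    exact var_mem I t
  mem_of_pos h hx := mem_maximalIdeal_of_pos h hx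
  finite_one := Module.Finite.iff_fg.2 ((homogeneousSubmodule_fg (Fin n) K 1).map _)

/-- The polynomials of weight at most `k`. -/
def weightLE (K : Type*) [Field K] {n : ℕ} (a : Fin n → ℕ) (k : ℕ) :
    Submodule K (MvPolynomial (Fin n) K) where
  carrier := {f | ∀ d, k < Finsupp.weight a d → coeff d f = 0}
  zero_mem' := fun _ _ => coeff_zero _
  add_mem' := fun hf hg d hd => by rw [coeff_add, hf d hd, hg d hd, add_zero]
  smul_mem' := fun c f hf d hd => by rw [coeff_smul, hf d hd, smul_zero]

variable {a : Fin n → ℕ} {k l : ℕ} {f g : MvPolynomial (Fin n) K}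

lemma mul_mem_weightLE (hf : f ∈ weightLE K a k) (hg : g ∈ weightLE K a l) :
    f * g ∈ weightLE K a (k + l) := by
  intro d hd
  rw [coeff_mul]
  refine Finset.sum_eq_zero fun p hp => ?_
  rw [← Finset.HasAntidiagonal.mem_antidiagonal.1 hp, map_add] at hd
  rcases lt_or_ge k (Finsupp.weight a p.1) with h | h
  · rw [hf _ h, zero_mul]
  · rw [hg _ (by omega), mul_zero]

/-- In top weight `k + l`, a factor of weight below `k` forces the other above `l`, so only top
components contribute. -/
lemma component_mul (hf : f ∈ weightLE K a k) (hg : g ∈ weightLE K a l) :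
    weightedHomogeneousComponent a (k + l) (f * g) =
      weightedHomogeneousComponent a k f * weightedHomogeneousComponent a l g := by
  classical
  ext d
  rw [coeff_weightedHomogeneousComponent, coeff_mul, coeff_mul]
  split_ifs with hd
  · refine Finset.sum_congr rfl fun p hp => ?_
    rw [← Finset.HasAntidiagonal.mem_antidiagonal.1 hp, map_add] at hd
    rw [coeff_weightedHomogeneousComponent, coeff_weightedHomogeneousComponent]
    rcases lt_trichotomy (Finsupp.weight a p.1) k with h | h | h
    · rw [hg _ (by omega), if_neg h.ne, mul_zero, zero_mul]
    · rw [if_pos h, if_pos (by omega)]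
    · rw [hf _ h, ite_self, zero_mul, zero_mul]
  · refine (Finset.sum_eq_zero fun p hp => ?_).symm
    rw [← Finset.HasAntidiagonal.mem_antidiagonal.1 hp, map_add] at hd
    rw [coeff_weightedHomogeneousComponent, coeff_weightedHomogeneousComponent]
    by_cases h : Finsupp.weight a p.1 = k
    · rw [if_neg (show ¬ Finsupp.weight a p.2 = l by omega), mul_zero]
    · rw [if_neg h, zero_mul]

lemma component_eq_zero_of_lt (hf : f ∈ weightLE K a k) (h : k < l) :
    weightedHomogeneousComponent a l f = 0 := by
  classical
  ext d
  rw [coeff_weightedHomogeneousComponent]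
  split_ifs with hd
  · rw [hf d (by omega), coeff_zero]
  · rfl

lemma weightLE_mono (h : k ≤ l) : weightLE K a k ≤ weightLE K a l :=
  fun _ hf d hd => hf d (by omega)

lemma component_zero_eq_self (hf : f ∈ weightLE K a 0) :
    weightedHomogeneousComponent a 0 f = f := by
  classical
  ext d
  rw [coeff_weightedHomogeneousComponent]
  split_ifs with hd
  · rfl
  · rw [hf d (by omega)]

lemma mem_weightLE_of_component_eq_zero (hf : f ∈ weightLE K a (k + 1))
    (h : weightedHomogeneousComponent a (k + 1) f = 0) : f ∈ weightLE K a k := by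
  classical
  intro d hd
  rcases (show k + 1 ≤ Finsupp.weight a d from hd).eq_or_lt with hd' | hd'
  · have := congrArg (coeff d) h
    rwa [coeff_weightedHomogeneousComponent, if_pos hd'.symm, coeff_zero] at this
  · exact hf d hd'

lemma mem_weightLE_of_isWeightedHomogeneous (hf : IsWeightedHomogeneous a f k) :
    f ∈ weightLE K a k :=
  fun _ hd => hf.coeff_eq_zero _ (by omega)

lemma mem_weightLE_weightedTotalDegree (a : Fin n → ℕ) (f : MvPolynomial (Fin n) K) :
    f ∈ weightLE K a (weightedTotalDegree a f) := by
  intro d hd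
  by_contra h
  exact absurd (le_weightedTotalDegree a (mem_support_iff.2 h)) (by omega)

lemma component_homogeneousComponent (a : Fin n → ℕ) (k j : ℕ) (f : MvPolynomial (Fin n) K) :
    weightedHomogeneousComponent a k (homogeneousComponent j f) =
      homogeneousComponent j (weightedHomogeneousComponent a k f) := by
  classical
  ext d
  simp only [coeff_weightedHomogeneousComponent, coeff_homogeneousComponent]
  split_ifs <;> rfl

lemma homogeneousComponent_mem_weightLE (hf : f ∈ weightLE K a k) (j : ℕ) :
    homogeneousComponent j f ∈ weightLE K a k := by
  classical
  intro d hd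
  rw [coeff_homogeneousComponent, hf d hd, ite_self]

lemma component_mem_initialIdeal (hg : g ∈ I) (hk : g ∈ weightLE K a k) :
    weightedHomogeneousComponent a k g ∈ initialIdeal a I := by
  classical
  by_cases h : weightedHomogeneousComponent a k g = 0
  · rw [h]; exact zero_mem _
  · obtain ⟨d, hd⟩ := ne_zero_iff.1 h
    rw [coeff_weightedHomogeneousComponent] at hd
    have hdk : Finsupp.weight a d = k := by
      by_contra h'; simp [h'] at hd
    rw [if_pos hdk] at hd
    have : weightedTotalDegree a g = k := by
      refine le_antisymm (Finset.sup_le fun e he => ?_) ?_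
      · by_contra h'
        exact mem_support_iff.1 he (hk e (by omega))
      · rw [← hdk]
        exact le_weightedTotalDegree a (mem_support_iff.2 hd)
    exact Submodule.subset_span ⟨g, hg, by rw [initialForm, this]⟩

/-- The weight `k` component of a combination of initial forms retains just those of weight `k`;
adding the corresponding elements of `I` realizes it as the top component of a single element. -/
lemma exists_component_eq (hf : f ∈ initialIdeal a I) (k : ℕ) :
    ∃ g ∈ I, g ∈ weightLE K a k ∧
      weightedHomogeneousComponent a k g = weightedHomogeneousComponent a k f := by
  change f ∈ Submodule.span K (initialForm a '' (I : Set (MvPolynomial (Fin n) K))) at hf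
  induction hf using Submodule.span_induction with
  | zero => exact ⟨0, zero_mem _, zero_mem _, rfl⟩
  | mem f hf =>
    obtain ⟨g, hg, rfl⟩ := hf
    by_cases h : weightedTotalDegree a g = k
    · refine ⟨g, hg, h ▸ mem_weightLE_weightedTotalDegree a g, ?_⟩
      rw [initialForm, h]
      exact ((weightProj K a).proj_same ((weightProj K a).proj_mem k g)).symm
    · refine ⟨0, zero_mem _, zero_mem _, ?_⟩
      rw [map_zero]
      exact ((weightProj K a).proj_ne ((weightProj K a).proj_mem _ g) h).symm
  | add f₁ f₂ _ _ h₁ h₂ =>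
    obtain ⟨g₁, h₁, h₁', h₁''⟩ := h₁
    obtain ⟨g₂, h₂, h₂', h₂''⟩ := h₂
    exact ⟨g₁ + g₂, add_mem h₁ h₂, add_mem h₁' h₂', by rw [map_add, map_add, h₁'', h₂'']⟩
  | smul c f _ h =>
    obtain ⟨g, h, h', h''⟩ := h
    refine ⟨c • g, ?_, Submodule.smul_mem _ _ h', by rw [map_smul, map_smul, h'']⟩
    rw [smul_eq_C_mul]
    exact I.mul_mem_left _ h

lemma component_mem_of_mem_initialIdeal (hf : f ∈ initialIdeal a I) (k : ℕ) :
    weightedHomogeneousComponent a k f ∈ initialIdeal a I := by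
  obtain ⟨g, hg, hgk, h⟩ := exists_component_eq hf k
  exact h ▸ component_mem_initialIdeal hg hgk

lemma IsStdGraded.initialIdeal (hI : IsStdGraded I) (a : Fin n → ℕ) :
    IsStdGraded (initialIdeal a I) := by
  intro f hf j
  change f ∈ Submodule.span K (initialForm a '' (I : Set (MvPolynomial (Fin n) K))) at hf
  induction hf using Submodule.span_induction with
  | zero => rw [map_zero]; exact zero_mem _
  | mem f hf =>
    obtain ⟨g, hg, rfl⟩ := hf
    rw [initialForm, ← component_homogeneousComponent]
    exact component_mem_initialIdeal (hI g hg j)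
      (homogeneousComponent_mem_weightLE (mem_weightLE_weightedTotalDegree a g) j)
  | add f₁ f₂ _ _ h₁ h₂ => rw [map_add]; exact add_mem h₁ h₂
  | smul c f _ h =>
    rw [map_smul, smul_eq_C_mul]
    exact Ideal.mul_mem_left _ _ h

/-- This allows a representative modulo `I` to be replaced by one of smaller weight when its symbol
vanishes. -/
lemma exists_sub_mem_weightLE (hf : f ∈ weightLE K a k)
    (h : weightedHomogeneousComponent a k f ∈ initialIdeal a I) :
    ∃ g ∈ I, f - g ∈ weightLE K a k ∧ weightedHomogeneousComponent a k (f - g) = 0 := by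
  obtain ⟨g, hg, hgk, hgf⟩ := exists_component_eq h k
  refine ⟨g, hg, sub_mem hf hgk, ?_⟩
  rw [map_sub, hgf, sub_eq_zero]
  exact ((weightProj K a).proj_same ((weightProj K a).proj_mem k f)).symm

lemma isHomogeneous_of_mem_weightLE_zero (ha : ∀ i, 0 < a i) (hf : f ∈ weightLE K a 0) :
    IsHomogeneous f 0 := by
  intro d hd
  have : ¬ 0 < Finsupp.weight a d := fun h => hd (hf d h)
  have h0 : d = 0 := by
    ext i
    have h1 : Finsupp.weight a d = 0 := by omega
    rw [Finsupp.weight_apply, Finsupp.sum, Finset.sum_eq_zero_iff] at h1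
    by_contra h2
    have := h1 i (Finsupp.mem_support_iff.2 h2)
    simp only [smul_eq_mul, mul_eq_zero] at this
    exact this.elim h2 (ha i).ne'
  rw [h0, map_zero]

lemma coeff_zero_of_isWeightedHomogeneous (hk : 0 < k) (hf : IsWeightedHomogeneous a f k) :
    coeff 0 f = 0 :=
  hf.coeff_eq_zero _ (by rw [map_zero]; exact hk.ne)

/-- The degeneration of `R/I` to `R/in_a(I)`. -/
def initialDegeneration (hI : IsStdGraded I) (ha : ∀ i, 0 < a i) :
    Degeneration (standardGrading I) (maximalIdeal I) (standardGrading (initialIdeal a I))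
      (quotientGrading (weightedHomogeneousSubmodule K a) (initialIdeal a I))
      (maximalIdeal (initialIdeal a I)) where
  stdA := hI.standardGraded
  stdB := (hI.initialIdeal a).standardGraded
  weight := (weightProj K a).quotient _ fun _ hf k => component_mem_of_mem_initialIdeal hf k
  weight_mul := mul_mem_quotientGrading (fun _ _ _ _ hx hy => IsWeightedHomogeneous.mul hx hy) _
  weight_proj_mem := by
    rintro i j _ ⟨f, hf, rfl⟩
    refine ⟨weightedHomogeneousComponent a i f, ?_, rfl⟩
    rw [← (stdProj K n).proj_same hf]
    change weightedHomogeneousComponent a i (homogeneousComponent j f) ∈ _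
    rw [component_homogeneousComponent]
    exact (stdProj K n).proj_mem j _
  rel k := (weightLE K a k).map ((Ideal.Quotient.mkₐ K I).toLinearMap.prod
    ((Ideal.Quotient.mkₐ K (initialIdeal a I)).toLinearMap ∘ₗ weightedHomogeneousComponent a k))
  mul_mem := by
    rintro k l x y x' y' ⟨f, hf, h⟩ ⟨g, hg, h'⟩
    obtain ⟨rfl, rfl⟩ := Prod.ext_iff.1 h
    obtain ⟨rfl, rfl⟩ := Prod.ext_iff.1 h'
    refine ⟨f * g, mul_mem_weightLE hf hg, Prod.ext (map_mul (Ideal.Quotient.mk I) _ _) ?_⟩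
    change Ideal.Quotient.mk _ (weightedHomogeneousComponent a (k + l) (f * g)) = _
    rw [component_mul hf hg]
    exact map_mul (Ideal.Quotient.mk _) _ _
  symbol_eq_zero := by
    rintro k y ⟨f, hf, h⟩
    obtain ⟨h1, rfl⟩ := Prod.ext_iff.1 h
    exact Ideal.Quotient.eq_zero_iff_mem.2
      (component_mem_initialIdeal (Ideal.Quotient.eq_zero_iff_mem.1 h1) hf)
  eq_zero_of_rel_zero := by
    rintro x ⟨f, hf, h⟩
    obtain ⟨rfl, h1⟩ := Prod.ext_iff.1 h
    obtain ⟨g, hg, h2, h3⟩ := exists_sub_mem_weightLE hf (Ideal.Quotient.eq_zero_iff_mem.1 h1)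
    rw [component_zero_eq_self h2, sub_eq_zero] at h3
    exact Ideal.Quotient.eq_zero_iff_mem.2 (h3 ▸ hg)
  lower := by
    rintro k x ⟨f, hf, h⟩
    obtain ⟨rfl, h1⟩ := Prod.ext_iff.1 h
    obtain ⟨g, hg, h2, h3⟩ := exists_sub_mem_weightLE hf (Ideal.Quotient.eq_zero_iff_mem.1 h1)
    refine ⟨_, f - g, mem_weightLE_of_component_eq_zero h2 h3, Prod.ext ?_ rfl⟩
    exact (Ideal.Quotient.eq.2 (by simpa using hg) :
      Ideal.Quotient.mk I (f - g) = Ideal.Quotient.mk I f)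
  raise := by
    rintro k l x y ⟨f, hf, h⟩ hkl
    obtain ⟨rfl, -⟩ := Prod.ext_iff.1 h
    refine ⟨f, weightLE_mono hkl.le hf, Prod.ext rfl ?_⟩
    change Ideal.Quotient.mk _ (weightedHomogeneousComponent a l f) = 0
    rw [component_eq_zero_of_lt hf hkl, map_zero]
  exists_rel_of_symbol := by
    rintro k _ ⟨f, hf, rfl⟩
    refine ⟨_, f, mem_weightLE_of_isWeightedHomogeneous hf, Prod.ext rfl ?_⟩
    exact congrArg (Ideal.Quotient.mk _) ((weightProj K a).proj_same hf)
  exists_rel x := by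
    obtain ⟨f, rfl⟩ := Ideal.Quotient.mk_surjective x
    exact ⟨_, _, f, mem_weightLE_weightedTotalDegree a f, rfl⟩
  symbol_mem := by
    rintro k x y ⟨f, hf, h⟩
    obtain ⟨-, rfl⟩ := Prod.ext_iff.1 h
    exact ⟨_, (weightProj K a).proj_mem k f, rfl⟩
  proj_mem := by
    rintro k x y ⟨f, hf, h⟩ j
    obtain ⟨rfl, rfl⟩ := Prod.ext_iff.1 h
    refine ⟨homogeneousComponent j f, homogeneousComponent_mem_weightLE hf j, ?_⟩
    refine Prod.ext (show Ideal.Quotient.mk I _ = Ideal.Quotient.mk I _ from rfl) ?_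
    exact congrArg (Ideal.Quotient.mk _) (component_homogeneousComponent a k j f)
  symbol_mem_ideal := by
    rintro k x y ⟨f, hf, h⟩ hx
    obtain ⟨rfl, rfl⟩ := Prod.ext_iff.1 h
    -- As the weights of the variables are positive, weight 0 means constant. A constant whose class
    -- lies in the maximal ideal is zero in the quotient, which also covers `I = R`.
    rcases Nat.eq_zero_or_pos k with rfl | hk
    · have := hI.standardGraded.eq_zero_of_mem hx
        (mk_mem_quotientGrading (isHomogeneous_of_mem_weightLE_zero ha hf))
      have := component_mem_initialIdeal (Ideal.Quotient.eq_zero_iff_mem.1 this) hf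
      have h0 := Ideal.Quotient.eq_zero_iff_mem.2 this
      change Ideal.Quotient.mk _ (weightedHomogeneousComponent a 0 f) ∈ _
      rw [h0]
      exact zero_mem _
    · exact mem_maximalIdeal_of_coeff_zero
        (coeff_zero_of_isWeightedHomogeneous hk ((weightProj K a).proj_mem k f))
  exists_rel_ideal := by
    rintro k _ hy ⟨f, hf, rfl⟩
    rcases Nat.eq_zero_or_pos k with rfl | hk
    · have := (hI.initialIdeal a).standardGraded.eq_zero_of_mem hy (mk_mem_quotientGrading
        (isHomogeneous_of_mem_weightLE_zero ha (mem_weightLE_of_isWeightedHomogeneous hf)))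
      exact ⟨0, zero_mem _, by rw [this]; exact zero_mem _⟩
    · refine ⟨_, mem_maximalIdeal_of_coeff_zero (coeff_zero_of_isWeightedHomogeneous hk hf), f,
        mem_weightLE_of_isWeightedHomogeneous hf, Prod.ext rfl ?_⟩
      exact congrArg (Ideal.Quotient.mk _) ((weightProj K a).proj_same hf)

theorem isKoszul_of_initialIdeal (hI : IsStdGraded I) (ha : ∀ i, 0 < a i)
    (h : IsKoszul (initialIdeal a I)) : IsKoszul I :=
  (initialDegeneration hI ha).isKoszulAlgebra h

end Polynomial

/-! ### Linear quotients -/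

section LinearQuotients

variable {K : Type*} [Field K] {A : Type*} [CommRing A] [Algebra K A]
  {𝒜 : ℕ → Submodule K A} {𝔪 : Ideal A} {τ : Type}

/-- A family of linear forms such that all colon ideals of ideals generated by members of the
family by further members are again generated by members of the family. -/
structure IsKoszulFamily (𝒜 : ℕ → Submodule K A) (𝔪 : Ideal A) (x : τ → A) : Prop where
  mem : ∀ t, x t ∈ 𝒜 1
  span : Ideal.span (Set.range x) = 𝔪
  colon : ∀ (T : Set τ) (t : τ), t ∉ T → ∃ T' : Set τ, ∀ b : A,
    b * x t ∈ Ideal.span (x '' T) ↔ b ∈ Ideal.span (x '' T')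

/-- A submodule of a free module with linear generators whose successive colon ideals are generated
by members of the family `x`. -/
structure LinearQuotients (𝒜 : ℕ → Submodule K A) (x : τ → A) where
  /-- the basis of the ambient free module -/
  ι : Type
  /-- the submodule -/
  Z : Submodule A (ι →₀ A)
  /-- the index set of the generators -/
  κ : Type
  order : LinearOrder κ
  finite : Finite κ
  /-- the generators -/
  v : κ → ι →₀ A
  mem : ∀ k c, v k c ∈ 𝒜 1
  span : Submodule.span A (Set.range v) = Z
  /-- the sets of generators of the colon ideals -/
  T : κ → Set τ
  colon : ∀ k b, b • v k ∈ Submodule.span A (v '' Set.Iio k) ↔ b ∈ Ideal.span (x '' T k)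

/-- The first syzygies of a module with linear quotients have linear quotients. -/
lemma LinearQuotients.exists_next [LinearOrder τ] [Finite τ] (S : StandardGraded 𝒜 𝔪) {x : τ → A}
    (hx : IsKoszulFamily 𝒜 𝔪 x) (s : LinearQuotients 𝒜 x) :
    ∃ (s' : LinearQuotients 𝒜 x) (D : (s'.ι →₀ A) →ₗ[A] (s.ι →₀ A)),
      LinearMap.range D = s.Z ∧ LinearMap.ker D = s'.Z ∧
      ∀ b c, D (Finsupp.single b 1) c ∈ 𝒜 1 := by
  obtain ⟨ι, Z, κ, _, _, v, hv, hspan, T, hcolon⟩ := s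
  dsimp only
  let D : (κ →₀ A) →ₗ[A] (ι →₀ A) := Finsupp.linearCombination A v
  have hD1 : ∀ b, D (Finsupp.single b 1) = v b := fun b => by simp [D]
  have hdeg : ∀ j, ∀ f ∈ freeGrading 𝒜 (fun _ : κ => 1) j,
      D f ∈ freeGrading 𝒜 (fun _ : ι => 0) j := by
    refine map_mem_of_basis (smul_mem_freeGrading S.mul_mem) D fun b c => ?_
    rw [hD1]
    exact ⟨fun _ => hv b c, fun h => absurd h (Nat.not_lt_zero _)⟩
  -- generators of the syzygies
  have hz : ∀ k t, ∃ z : κ →₀ A, t ∈ T k → D z = 0 ∧ (∀ c, z c ∈ 𝒜 1) ∧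
      z k = x t ∧ ∀ l, k < l → z l = 0 := by
    intro k t
    by_cases ht : t ∈ T k
    swap
    · exact ⟨0, fun h => absurd h ht⟩
    obtain ⟨c, hc, hcv⟩ := (Finsupp.mem_span_image_iff_linearCombination A).1
      ((hcolon k (x t)).2 (Ideal.subset_span ⟨t, ht, rfl⟩))
    have hc0 : ∀ l, k ≤ l → c l = 0 := fun l hl => by
      by_contra h
      exact absurd ((Finsupp.mem_supported A c).1 hc (Finsupp.mem_support_iff.2 h)) (not_lt.2 hl)
    have happ : ∀ l, (S.free fun _ : κ => 1).proj 2 (Finsupp.single k (x t) - c) l =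
        S.proj 1 ((Finsupp.single k (x t) - c) l) := fun l => rfl
    -- The relation `x t • v k = ∑ c l • v l` over `l < k` may have inhomogeneous coefficients. With
    -- basis elements in degree 1, its degree 2 part is a syzygy with linear coordinates and leading
    -- coordinate `x t`.
    refine ⟨(S.free fun _ => 1).proj 2 (Finsupp.single k (x t) - c), fun _ => ⟨?_, ?_, ?_, ?_⟩⟩
    · rw [HomogProj.map_proj _ (S.free fun _ => 0) D hdeg, map_sub]
      have : D (Finsupp.single k (x t)) = D c := by
        change _ = Finsupp.linearCombination A v c
        rw [hcv]
        simp [D]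
      rw [this, sub_self, map_zero]
    · intro l; rw [happ]; exact S.proj_mem 1 _
    · rw [happ, Finsupp.sub_apply, Finsupp.single_eq_same, hc0 k le_rfl, sub_zero,
        S.proj_same (hx.mem t)]
    · intro l hl
      rw [happ, Finsupp.sub_apply, Finsupp.single_eq_of_ne hl.ne', hc0 l hl.le, sub_zero, map_zero]
  choose z hz using hz
  -- the submodule generated by the syzygies with leading index `k` and leading variable in `U`
  let N : κ → Set τ → Submodule A (κ →₀ A) := fun k U => Submodule.span A (z k '' (T k ∩ U))
  have hNker : ∀ k U y, y ∈ N k U → D y = 0 ∧ ∀ l, k < l → y l = 0 := by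
    intro k U y hy
    induction hy using Submodule.span_induction with
    | zero => simp
    | add y y' _ _ h h' =>
      exact ⟨by rw [map_add, h.1, h'.1, add_zero],
        fun l hl => by rw [Finsupp.add_apply, h.2 l hl, h'.2 l hl, add_zero]⟩
    | smul a y _ h =>
      exact ⟨by rw [map_smul, h.1, smul_zero],
        fun l hl => by rw [Finsupp.smul_apply, h.2 l hl, smul_zero]⟩
    | mem y hy =>
      obtain ⟨t, ht, rfl⟩ := hy
      exact ⟨(hz k t ht.1).1, (hz k t ht.1).2.2.2⟩
  have hNcoord : ∀ k U b, b ∈ Ideal.span (x '' (T k ∩ U)) → ∃ y ∈ N k U, y k = b := by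
    intro k U b hb
    induction hb using Submodule.span_induction with
    | zero => exact ⟨0, zero_mem _, rfl⟩
    | add b b' _ _ h h' =>
      obtain ⟨y, hy, rfl⟩ := h
      obtain ⟨y', hy', rfl⟩ := h'
      exact ⟨y + y', add_mem hy hy', rfl⟩
    | smul a b _ h =>
      obtain ⟨y, hy, rfl⟩ := h
      exact ⟨a • y, Submodule.smul_mem _ a hy, rfl⟩
    | mem b hb =>
      obtain ⟨t, ht, rfl⟩ := hb
      exact ⟨z k t, Submodule.subset_span ⟨t, ht, rfl⟩, (hz k t ht.1).2.2.1⟩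
  have hlead : ∀ k y, D y = 0 → (∀ l, k < l → y l = 0) → y k ∈ Ideal.span (x '' T k) := by
    intro k y hy hyk
    rw [← hcolon]
    have h1 : D (Finsupp.single k (y k) - y) = y k • v k := by
      rw [map_sub, hy, sub_zero]
      simp [D]
    rw [← h1]
    refine (Finsupp.mem_span_image_iff_linearCombination A).2 ⟨_, ?_, rfl⟩
    rw [Finsupp.mem_supported]
    intro l hl
    rw [Finset.mem_coe, Finsupp.mem_support_iff] at hl
    by_contra h
    apply hl
    rcases (not_lt.1 h).eq_or_lt with rfl | h'
    · simp
    · rw [Finsupp.sub_apply, Finsupp.single_eq_of_ne h'.ne', hyk l h', sub_zero]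
  -- The leading coordinate of a syzygy lies in a colon ideal, so a combination of the `z m t`
  -- cancels it.
  have hpeel : ∀ y, D y = 0 → y ≠ 0 → ∃ m, y m ≠ 0 ∧ ∃ y' ∈ N m Set.univ,
      D (y - y') = 0 ∧ ∀ l, m ≤ l → (y - y') l = 0 := by
    intro y hy h0
    have hne : y.support.Nonempty := Finsupp.support_nonempty_iff.2 h0
    have hm : ∀ l, y.support.max' hne < l → y l = 0 := fun l hl => by
      by_contra h
      exact absurd (Finset.le_max' _ l (Finsupp.mem_support_iff.2 h)) (not_le.2 hl)
    obtain ⟨y', hy', hy'm⟩ := hNcoord (y.support.max' hne) Set.univ _ (by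
      rw [Set.inter_univ]; exact hlead _ y hy hm)
    refine ⟨_, Finsupp.mem_support_iff.1 (Finset.max'_mem _ hne), y', hy', ?_, fun l hl => ?_⟩
    · rw [map_sub, hy, (hNker _ _ _ hy').1, sub_zero]
    · rcases hl.eq_or_lt with rfl | hl
      · rw [Finsupp.sub_apply, hy'm, sub_self]
      · rw [Finsupp.sub_apply, hm l hl, (hNker _ _ _ hy').2 l hl, sub_zero]
  have hNle : ∀ k y, D y = 0 → (∀ l, k ≤ l → y l = 0) → y ∈ ⨆ l ∈ Set.Iio k, N l Set.univ := by
    intro k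
    induction k using WellFoundedLT.induction with
    | ind k ih =>
      intro y hy hyk
      by_cases h0 : y = 0
      · rw [h0]; exact zero_mem _
      obtain ⟨m, hm, y', hy', h1, h2⟩ := hpeel y hy h0
      have hmk : m < k := by
        by_contra h
        exact hm (hyk m (not_lt.1 h))
      have hle : (⨆ l ∈ Set.Iio m, N l Set.univ) ≤ ⨆ l ∈ Set.Iio k, N l Set.univ :=
        biSup_mono fun l hl => lt_trans hl hmk
      rw [← sub_add_cancel y y']
      exact add_mem (hle (ih m hmk _ h1 h2))
        (Submodule.mem_iSup_of_mem m (Submodule.mem_iSup_of_mem hmk hy'))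
  have hker : LinearMap.ker D = ⨆ l, N l Set.univ := by
    refine le_antisymm (fun y hy => ?_) (iSup_le fun l y hy => (hNker _ _ _ hy).1)
    by_cases h0 : y = 0
    · rw [h0]; exact zero_mem _
    obtain ⟨m, -, y', hy', h1, h2⟩ := hpeel y hy h0
    have hle : (⨆ l ∈ Set.Iio m, N l Set.univ) ≤ ⨆ l, N l Set.univ := iSup₂_le_iSup _ _
    rw [← sub_add_cancel y y']
    exact add_mem (hle (hNle m _ h1 h2)) (Submodule.mem_iSup_of_mem m hy')
  -- In the lexicographic order, all syzygies with smaller leading index precede `z k t`. Hence its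
  -- colon ideal is that of `x t` over the `x u` with `u ∈ T k` and `u < t`.
  let κ' := {p : κ ×ₗ τ // (ofLex p).2 ∈ T (ofLex p).1}
  let v' : κ' → κ →₀ A := fun p => z (ofLex p.1).1 (ofLex p.1).2
  choose T' hT' using fun p : κ' => hx.colon (T (ofLex p.1).1 ∩ Set.Iio (ofLex p.1).2)
    (ofLex p.1).2 fun h => lt_irrefl _ h.2
  have hNv : ∀ k U (W : Set κ'), (∀ t (ht : t ∈ T k), t ∈ U → ⟨toLex (k, t), ht⟩ ∈ W) →
      N k U ≤ Submodule.span A (v' '' W) := by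
    intro k U W h
    refine Submodule.span_mono ?_
    rintro _ ⟨t, ht, rfl⟩
    exact ⟨⟨toLex (k, t), ht.1⟩, h t ht.1 ht.2, rfl⟩
  refine ⟨⟨κ, LinearMap.ker D, κ', inferInstance, ?_, v', ?_, ?_, T', ?_⟩, D, ?_, rfl, ?_⟩
  · have : Finite (κ ×ₗ τ) := inferInstanceAs (Finite (κ × τ))
    exact inferInstanceAs (Finite {p : κ ×ₗ τ // (ofLex p).2 ∈ T (ofLex p).1})
  · exact fun p c => (hz _ _ p.2).2.1 c
  · rw [hker]
    refine le_antisymm (Submodule.span_le.2 ?_) (iSup_le fun k => ?_)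
    · rintro _ ⟨p, rfl⟩
      exact Submodule.mem_iSup_of_mem _ (Submodule.subset_span ⟨_, ⟨p.2, trivial⟩, rfl⟩)
    · rw [← Set.image_univ]
      exact hNv k _ _ fun _ _ _ => trivial
  · rintro ⟨⟨k, t⟩, ht : t ∈ T k⟩ b
    rw [← hT']
    change b • z k t ∈ _ ↔ b * x t ∈ Ideal.span (x '' (T k ∩ Set.Iio t))
    rw [← (hz k t ht).2.2.1]
    constructor
    · intro h
      have h1 := Submodule.mem_map_of_mem (f := Finsupp.lapply (R := A) k) h
      rw [Submodule.map_span] at h1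
      refine Submodule.span_le.2 ?_ h1
      rintro _ ⟨_, ⟨⟨⟨l, u⟩, hu : u ∈ T l⟩, hlt, rfl⟩, rfl⟩
      change z l u k ∈ _
      have hlt' : toLex (l, u) < toLex (k, t) := hlt
      rw [Prod.Lex.toLex_lt_toLex] at hlt'
      rcases hlt' with hlt' | ⟨rfl, hlt'⟩
      · rw [(hz l u hu).2.2.2 k hlt']
        exact zero_mem _
      · rw [(hz l u hu).2.2.1]
        exact Ideal.subset_span ⟨u, ⟨hu, hlt'⟩, rfl⟩
    -- Subtracting a combination of the `z k u` with `u < t` removes the coordinate at `k`; what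
    -- remains is a syzygy supported below `k`, generated by earlier elements.
    · intro h
      obtain ⟨y, hy, hyk⟩ := hNcoord k (Set.Iio t) _ h
      have h1 := hNle k (b • z k t - y) (by
        rw [map_sub, map_smul, (hz k t ht).1, (hNker _ _ _ hy).1, smul_zero, sub_zero]) (by
        intro l hl
        rcases hl.eq_or_lt with rfl | hl
        · rw [Finsupp.sub_apply, hyk, Finsupp.smul_apply, smul_eq_mul, sub_self]
        · rw [Finsupp.sub_apply, Finsupp.smul_apply, (hz k t ht).2.2.2 l hl,
            (hNker _ _ _ hy).2 l hl, smul_zero, sub_zero])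
      rw [← sub_add_cancel (b • z k t) y]
      refine add_mem (iSup₂_le (fun l hl => hNv l _ _ fun u hu _ => ?_) h1)
        (hNv k _ _ (fun u hu hut => ?_) hy)
      · exact Prod.Lex.toLex_lt_toLex.2 (Or.inl hl)
      · exact Prod.Lex.toLex_lt_toLex.2 (Or.inr ⟨rfl, hut⟩)
  · rw [Finsupp.range_linearCombination, hspan]
  · intro b c
    rw [hD1]
    exact hv b c

theorem IsKoszulFamily.isKoszulAlgebra [LinearOrder τ] [Finite τ] (S : StandardGraded 𝒜 𝔪)
    {x : τ → A} (hx : IsKoszulFamily 𝒜 𝔪 x) : IsKoszulAlgebra 𝒜 𝔪 := by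
  choose next D hrange hker hdeg using fun s : LinearQuotients 𝒜 x => s.exists_next S hx
  choose T hT using fun t => hx.colon (Set.Iio t) t (lt_irrefl t)
  have himage : ∀ U : Set τ, Submodule.span A ((fun t => Finsupp.single (0 : Fin 1) (x t)) '' U) =
      Submodule.map (Finsupp.lsingle (0 : Fin 1)) (Ideal.span (x '' U)) := by
    intro U
    rw [Ideal.span, Submodule.map_span, ← Set.image_comp]
    rfl
  let s₀ : LinearQuotients 𝒜 x :=
    { ι := Fin 1
      Z := rankOne 𝔪
      κ := τ
      order := inferInstance
      finite := inferInstance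
      v := fun t => Finsupp.single 0 (x t)
      mem := fun t c => by
        rw [Subsingleton.elim c 0, Finsupp.single_eq_same]
        exact hx.mem t
      span := by
        rw [← Set.image_univ, himage, Set.image_univ, hx.span]
        ext f
        constructor
        · rintro ⟨b, hb, rfl⟩
          rw [mem_rankOne]
          simpa using hb
        · intro hf
          refine ⟨f 0, hf, ?_⟩
          ext
          simp
      T := T
      colon := fun t b => by
        rw [himage, ← hT, Finsupp.smul_single, smul_eq_mul]
        constructor
        · rintro ⟨c, hc, h⟩
          rwa [← Finsupp.single_injective _ h]
        · exact fun h => ⟨_, h, rfl⟩ }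
  let s : ∀ _ : ℕ, LinearQuotients 𝒜 x := fun i => Nat.rec s₀ (fun _ => next) i
  refine S.isKoszulAlgebra_of_linear (fun i => (s i).ι) (fun i => D (s i))
    (rankOneAug 𝔪) (fun i => hdeg (s i)) (fun b => ?_) (fun i => ?_) ?_ rankOneAug_surjective
  · exact ⟨1, S.one_mem, (rankOneAug_single b 1).symm⟩
  · rw [LinearMap.exact_iff, hrange]
    exact hker (s i)
  · exact LinearMap.exact_iff.2 (ker_rankOneAug.trans (hrange (s 0)).symm)

end LinearQuotients

/-! ### Quadratic monomial ideals -/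

section Monomial

open MvPolynomial

variable {K : Type*} [Field K] {n : ℕ} {J : Ideal (MvPolynomial (Fin n) K)}
  {S : Set (Fin n →₀ ℕ)}

/-- Pulled back to the polynomial ring, the ideal is generated by monomials, so membership is tested
monomial by monomial. -/
lemma mk_mem_span_var_iff (hJ : J = Ideal.span ((fun m => monomial m (1 : K)) '' S))
    (T : Set (Fin n)) (f : MvPolynomial (Fin n) K) :
    Ideal.Quotient.mk J f ∈ Ideal.span ((fun t => Ideal.Quotient.mk J (X t)) '' T) ↔
      ∀ d ∈ f.support, (∃ s ∈ T, Finsupp.single s 1 ≤ d) ∨ ∃ e ∈ S, e ≤ d := by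
  have h1 : Ideal.span ((fun t => Ideal.Quotient.mk J (X t)) '' T) =
      (Ideal.span (X '' T)).map (Ideal.Quotient.mk J) := by
    rw [Ideal.map_span, ← Set.image_comp]
    rfl
  have h2 : Ideal.span (X '' T) ⊔ J = Ideal.span ((fun m => monomial m (1 : K)) ''
      ((fun t => Finsupp.single t 1) '' T ∪ S)) := by
    rw [Set.image_union, Ideal.span_union, ← hJ, ← Set.image_comp]
    rfl
  rw [h1, Ideal.mem_quotient_iff_mem_sup, h2, mem_ideal_span_monomial_image]
  refine forall₂_congr fun d _ => ⟨?_, ?_⟩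
  · rintro ⟨_, ⟨s, hs, rfl⟩ | he, hd⟩
    · exact Or.inl ⟨s, hs, hd⟩
    · exact Or.inr ⟨_, he, hd⟩
  · rintro (⟨s, hs, hd⟩ | ⟨e, he, hd⟩)
    · exact ⟨_, Or.inl ⟨s, hs, rfl⟩, hd⟩
    · exact ⟨e, Or.inr he, hd⟩

lemma exists_eq_single_add_single {e : Fin n →₀ ℕ} (he : e.degree = 2) {t : Fin n}
    (ht : e t ≠ 0) : ∃ s, e = Finsupp.single s 1 + Finsupp.single t 1 := by
  have h1 : Finsupp.single t 1 ≤ e := by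
    rw [Finsupp.single_le_iff]; omega
  obtain ⟨e', rfl⟩ := exists_add_of_le h1
  rw [map_add, Finsupp.degree_single] at he
  have h2 : e' ≠ 0 := by rintro rfl; simp at he
  obtain ⟨s, hs⟩ := Finsupp.ne_iff.1 h2
  have h3 : Finsupp.single s 1 ≤ e' := by
    rw [Finsupp.single_le_iff]; rw [Finsupp.zero_apply] at hs; omega
  obtain ⟨e'', rfl⟩ := exists_add_of_le h3
  rw [map_add, Finsupp.degree_single] at he
  have h4 : e'' = 0 := (Finsupp.degree_eq_zero_iff _).1 (by omega)
  exact ⟨s, by rw [h4, add_zero, add_comm]⟩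

/-- The colon by `X t` is generated by `T` and the variables `X s` with `X s * X t ∈ S`. Indeed, if
a generator `e` of `J` divides `d * X t`, then either `e` does not involve `X t` and divides `d`, or
`e = X s * X t` and `X s` divides `d`; the case `s = t` is included. -/
lemma isKoszulFamily_var (hS : ∀ m ∈ S, m.degree = 2)
    (hJ : J = Ideal.span ((fun m => monomial m (1 : K)) '' S)) :
    IsKoszulFamily (standardGrading J) (maximalIdeal J) fun t => Ideal.Quotient.mk J (X t) where
  mem := var_mem J
  span := (maximalIdeal_eq_span J).symm
  colon T t ht := by
    refine ⟨T ∪ {s | Finsupp.single s 1 + Finsupp.single t 1 ∈ S}, fun b => ?_⟩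
    obtain ⟨f, rfl⟩ := Ideal.Quotient.mk_surjective b
    rw [← map_mul, mk_mem_span_var_iff hJ, mk_mem_span_var_iff hJ, support_mul_X]
    simp only [Finset.mem_map, forall_exists_index, and_imp, forall_apply_eq_imp_iff₂,
      addRightEmbedding_apply]
    refine forall₂_congr fun d _ => ⟨?_, ?_⟩
    · rintro (⟨s, hs, hd⟩ | ⟨e, he, hd⟩)
      · refine Or.inl ⟨s, Or.inl hs, ?_⟩
        rw [Finsupp.single_le_iff] at hd ⊢
        -- Because `t ∉ T`, a variable from `T` dividing `d * X t` already divides `d`.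
        have : s ≠ t := fun h => ht (h ▸ hs)
        rwa [Finsupp.add_apply, Finsupp.single_eq_of_ne this, add_zero] at hd
      · by_cases het : e t = 0
        · refine Or.inr ⟨e, he, fun i => ?_⟩
          have := hd i
          by_cases hi : i = t
          · rw [hi, het]; exact Nat.zero_le _
          · rwa [Finsupp.add_apply, Finsupp.single_eq_of_ne hi, add_zero] at this
        · obtain ⟨s, rfl⟩ := exists_eq_single_add_single (hS e he) het
          exact Or.inl ⟨s, Or.inr he, le_of_add_le_add_right hd⟩
    · rintro (⟨s, hs | hs, hd⟩ | ⟨e, he, hd⟩)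
      · exact Or.inl ⟨s, hs, hd.trans le_self_add⟩
      · exact Or.inr ⟨_, hs, add_le_add_left hd _⟩
      · exact Or.inr ⟨e, he, hd.trans le_self_add⟩

/-- Quotients by quadratic monomial ideals are Koszul. -/
theorem isKoszul_of_quadratic_monomial (hgr : IsStdGraded J) (hS : ∀ m ∈ S, m.degree = 2)
    (hJ : J = Ideal.span ((fun m => monomial m (1 : K)) '' S)) : IsKoszul J :=
  (isKoszulFamily_var hS hJ).isKoszulAlgebra hgr.standardGraded

end Monomial

end KoszulTransfer

end

/-! ### Both parts of the theorem -/

theorem mainTheorem7 {K : Type*} [Field K] {n : ℕ} (I : Ideal (MvPolynomial (Fin n) K))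
    (hI : ∀ f ∈ I, ∀ j : ℕ, MvPolynomial.homogeneousComponent j f ∈ I) :
    (∀ a : Fin n → ℕ, (∀ k, 0 < a k) →
      KoszulTransfer.IsKoszul (KoszulTransfer.initialIdeal a I) →
        KoszulTransfer.IsKoszul I) ∧
    (∀ a : Fin n → ℕ, (∀ k, 0 < a k) →
      (∃ S : Set (Fin n →₀ ℕ), (∀ m ∈ S, m.degree = 2) ∧
        KoszulTransfer.initialIdeal a I =
          Ideal.span ((fun m => MvPolynomial.monomial m (1 : K)) '' S)) →
        KoszulTransfer.IsKoszul I) := by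
  refine ⟨fun a ha h => KoszulTransfer.isKoszul_of_initialIdeal hI ha h, ?_⟩
  rintro a ha ⟨S, hS, hJ⟩
  exact KoszulTransfer.isKoszul_of_initialIdeal hI ha
    (KoszulTransfer.isKoszul_of_quadratic_monomial
      (KoszulTransfer.IsStdGraded.initialIdeal hI a) hS hJ)
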